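/- **Setting.** Let $d\in\{2,3\}$, let $\Omega\subset\mathbb R^d$ be a bounded Lipschitz domain with polygonal (polyhedral) boundary, and let $A:\Omega\to\mathbb R^{d\times d}$ be measurable, pointwise symmetric and such that $\alpha|\zeta|^2\le A(x)\zeta\cdot\zeta\le\beta|\zeta|^2$ for all $\zeta\in\mathbb R^d$, $x\in\Omega$, with constants $0<\alpha<\beta$. For $\omega\subset\Omega$ put $a_\omega(u,v)=\int_\omega (A\nabla u)\cdot\nabla v\,dx$, $\|u\|_{a,\omega}=a_\omega(u,u)^{1/2}$ and $a=a_\Omega$. Let $\tau_h$ be a conforming triangulation of $\Omega$ into simplices and $V_h\subset H^1_0(\Omega)$ the Lagrange finite element space of continuous functions that are polynomials of degree at most $r$ on each element and vanish on $\partial\Omega$ ($r\ge1$), with basis $\psi_1,\dots,\psi_n$ and Lagrange interpolation operator $I_h$. For a linear functional $\ell$ on $V_h$, let $\mathbf A=(a(\psi_k,\psi_l))_{k,l}$, $\mathbf f=(\ell(\psi_k))_k$ and $\mathbf A\mathbf u=\mathbf f$. For subdomains $\omega$ resolved by the mesh (interiors of unions of closed elements) put $V_h(\omega)=\{v|_\omega: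 v\in V_h\}$ and $V_{h,0}(\omega)=\{v\in V_h:\operatorname{supp}v\subset\overline\omega\}$. Let $\Omega=\bigcup_{i=1}^M\omega_i$ and $\omega_i\subset\omega_i^*\subset\Omega$, all $\omega_i,\omega_i^*$ being resolved by the mesh; let $\xi$ (resp. $\xi^*$) be the maximal number of the $\omega_i$ (resp. $\omega_i^*$) that overlap at a point of $\Omega$. Let $\{\chi_i\}$ be a partition of unity on $\Omega$ consisting of continuous functions with $0\le\chi_i\le1$, $\operatorname{supp}\chi_i\subset\overline{\omega_i}$, $\sum_i\chi_i=1$, and let $\chi_{h,i}:V_h(\omega_i)\to V_{h,0}(\omega_i)$, $\chi_{h,i}(v)=I_h(\chi_iv)$. Let $V_{h,A}(\omega_i^*)=\{v\in V_h(\omega_i^*): a_{\omega_i^*}(v,w)=0\ \forall w\in V_{h,0}(\omega_i^*)\}$, let $\phi_{i,1},\dots,\phi_{i,N_i}$ be a basis of $V_{h,A}(\omega_i^*)$ of eigenfunctions of $$a_{\omega_i}\big(\chi_{h,i}(\phi|_{\omega_i}),\chi_{h,i}(v|_{\omega_i})\big)=\lambda\,a_{\omega_i^*}(\phi,v)\qquad\forall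 v\in V_{h,A}(\omega_i^*),$$ with eigenvalues $\infty\ge\lambda_{i,1}\ge\dots\ge\lambda_{i,N_i}\ge0$ (where $\lambda=\infty$ means $a_{\omega_i^*}(\phi,v)=0$ for all $v\in V_{h,A}(\omega_i^*)$), and let $0\le m_i\le N_i$, $\lambda_{i,N_i+1}:=0$. Put $$S_m(\Omega)=\Big\{\sum_i\chi_{h,i}(\phi_i):\phi_i\in\operatorname{span}\{\phi_{i,1}|_{\omega_i},\dots,\phi_{i,m_i}|_{\omega_i}\}\Big\},\qquad \Lambda=\Big(\xi\xi^*\max_{1\le i\le M}\lambda_{i,m_i+1}\Big)^{1/2}.$$ Let $\widetilde{\mathbf R}_i^T$, $\mathbf R_S^T$ and $\widetilde{\boldsymbol\chi}_i$ be the matrices, with respect to $\{\psi_k\}$ and arbitrary bases of $V_{h,0}(\omega_i^*)$ and $S_m(\Omega)$, of the embeddings $V_{h,0}(\omega_i^*)\to V_h$, $S_m(\Omega)\to V_h$ and of the map $V_{h,0}(\omega_i^*)\to V_{h,0}(\omega_i^*)$, $v\mapsto\chi_{h,i}(v|_{\omega_i})$. With $\widetilde{\mathbf A}_i=\widetilde{\mathbf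 R}_i\mathbf A\widetilde{\mathbf R}_i^T$ and $\mathbf A_S=\mathbf R_S\mathbf A\mathbf R_S^T$, the two-level hybrid RAS preconditioner is $$\mathbf B=\mathbf B_1+\mathbf R_S^T\mathbf A_S^{-1}\mathbf R_S(\mathbf I-\mathbf A\mathbf B_1),\qquad \mathbf B_1=\sum_{i=1}^M\widetilde{\mathbf R}_i^T\widetilde{\boldsymbol\chi}_i\widetilde{\mathbf A}_i^{-1}\widetilde{\mathbf R}_i .$$ Let $b(\cdot,\cdot)$ be an inner product on $\mathbb R^n$ with norm $\|\cdot\|_b$, let $\|\mathbf v\|_a=(\mathbf v^T\mathbf A\mathbf v)^{1/2}$, and let $b_1,b_2>0$ satisfy $b_1\|\mathbf v\|_b\le\|\mathbf v\|_a\le b_2\|\mathbf v\|_b$ for all $\mathbf v\in\mathbb R^n$. Let $\mathbf u^0\in\mathbb R^n$, and for $j\ge1$ let $\mathbf u^j$ be the $j$-th GMRES iterate for $\mathbf{BAu}=\mathbf{Bf}$, that is, a minimizer of $\|\mathbf{BA}(\mathbf u-\mathbf v)\|_b$ over $\mathbf v\in\mathbf u^0+\operatorname{span}\{(\mathbf{BA})^k(\mathbf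 u-\mathbf u^0):1\le k\le j\}$. **Theorem.** If $\Lambda<1$, then $$\|\mathbf{BA}(\mathbf u-\mathbf u^j)\|_b\le\Lambda^j\Big(\frac{1+\Lambda}{1-\Lambda}\Big)\frac{b_2}{b_1}\,\|\mathbf{BA}(\mathbf u-\mathbf u^0)\|_b,\qquad j=1,2,\dots$$ -/

import Mathlib

open MeasureTheory
open scoped ENNReal Matrix

noncomputable section

namespace MSGFEM

/-! ### The domain, the coefficient and the energy forms -/

/-- The Euclidean space `ℝ^d`. -/
abbrev Pt (d : ℕ) : Type := EuclideanSpace ℝ (Fin d)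

/-- A measurable matrix-valued coefficient on `Ω`, symmetric and uniformly elliptic with constants
`0 < α < β` (these bounds imply that its entries are essentially bounded). -/
structure IsEllipticCoefficient {d : ℕ} (Ω : Set (Pt d)) (α β : ℝ)
    (A : Pt d → Matrix (Fin d) (Fin d) ℝ) : Prop where
  alpha_pos : 0 < α
  alpha_lt_beta : α < β
  measurable_entries : ∀ k l, AEMeasurable (fun x => A x k l) (volume.restrict Ω)
  isSymm : ∀ᵐ x ∂(volume.restrict Ω), (A x).IsSymm
  lower : ∀ᵐ x ∂(volume.restrict Ω), ∀ ζ : Fin d → ℝ, α * (ζ ⬝ᵥ ζ) ≤ (A x *ᵥ ζ) ⬝ᵥ ζ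
  upper : ∀ᵐ x ∂(volume.restrict Ω), ∀ ζ : Fin d → ℝ, (A x *ᵥ ζ) ⬝ᵥ ζ ≤ β * (ζ ⬝ᵥ ζ)

/-- The bilinear form `a_ω(u, v) = ∫_ω (A ∇u) · ∇v dx`. It is only used for continuous piecewise
polynomial functions on open sets `ω`; these are differentiable off a null set (the element
boundaries), and there the classical gradient is the weak one. -/
def energy {d : ℕ} (A : Pt d → Matrix (Fin d) (Fin d) ℝ) (ω : Set (Pt d))
    (u v : Pt d → ℝ) : ℝ :=
  ∫ x in ω, (A x *ᵥ (gradient u x).ofLp) ⬝ᵥ (gradient v x).ofLp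

/-! ### Meshes and Lagrange finite element spaces -/

/-- A conforming triangulation of `Ω ⊆ ℝ^d` into finitely many `d`-simplices: a finite geometric
simplicial complex with underlying space `closure Ω`, all of whose faces belong to `d`-simplices. -/
structure Mesh {d : ℕ} (Ω : Set (Pt d)) where
  complex : Geometry.SimplicialComplex ℝ (Pt d)
  finite_faces : complex.faces.Finite
  pure : ∀ s ∈ complex.faces, ∃ T ∈ complex.faces, s ⊆ T ∧ T.card = d + 1
  space_eq : complex.space = closure Ω

/-- The elements (closed `d`-simplices, given by their vertex sets) of a mesh. -/
def Mesh.elements {d : ℕ} {Ω : Set (Pt d)} (𝒯 : Mesh Ω) : Set (Finset (Pt d)) :=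
  {T | T ∈ 𝒯.complex.faces ∧ T.card = d + 1}

/-- The subdomain `ω` is resolved by the mesh: it is the interior of a union of elements. -/
def Mesh.Resolves {d : ℕ} {Ω : Set (Pt d)} (𝒯 : Mesh Ω) (ω : Set (Pt d)) : Prop :=
  ∃ 𝒮 ⊆ 𝒯.elements, ω = interior (⋃ T ∈ 𝒮, convexHull ℝ (T : Set (Pt d)))

/-- The finite element space `V_h ⊂ H¹₀(Ω)`: continuous functions, zero outside `Ω`, that agree on
each element with a polynomial of total degree at most `r`. Members of `V_h` are represented by
their zero extensions to `ℝ^d`. -/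
def femSpace {d : ℕ} {Ω : Set (Pt d)} (𝒯 : Mesh Ω) (r : ℕ) : Submodule ℝ (Pt d → ℝ) where
  carrier := {v | Continuous v ∧ (∀ x, x ∉ Ω → v x = 0) ∧
    ∀ T ∈ 𝒯.elements, ∃ p : MvPolynomial (Fin d) ℝ, p.totalDegree ≤ r ∧
      ∀ x ∈ convexHull ℝ (T : Set (Pt d)), v x = MvPolynomial.eval (fun k => x k) p}
  add_mem' := by
    rintro u v ⟨hu, hu0, hup⟩ ⟨hv, hv0, hvp⟩
    refine ⟨hu.add hv, fun x hx => by simp [hu0 x hx, hv0 x hx], fun T hT => ?_⟩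
    obtain ⟨p, hp, hpe⟩ := hup T hT
    obtain ⟨q, hq, hqe⟩ := hvp T hT
    exact ⟨p + q, (MvPolynomial.totalDegree_add p q).trans (max_le hp hq),
      fun x hx => by simp [hpe x hx, hqe x hx]⟩
  zero_mem' := ⟨continuous_const, fun _ _ => rfl, fun _ _ => ⟨0, by simp, fun _ _ => by simp⟩⟩
  smul_mem' := by
    rintro c u ⟨hu, hu0, hup⟩
    refine ⟨hu.const_smul c, fun x hx => by simp [hu0 x hx], fun T hT => ?_⟩
    obtain ⟨p, hp, hpe⟩ := hup T hT
    exact ⟨c • p, (MvPolynomial.totalDegree_smul_le c p).trans hp,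
      fun x hx => by simp [hpe x hx]⟩

/-- The Lagrange nodes of order `r` of the mesh: on the element with vertices `y`, the points
`∑ y, (k y / r) • y` with natural numbers `k y` of sum `r`. -/
def IsNode {d : ℕ} {Ω : Set (Pt d)} (𝒯 : Mesh Ω) (r : ℕ) (z : Pt d) : Prop :=
  ∃ T ∈ 𝒯.elements, ∃ k : Pt d → ℕ, ∑ y ∈ T, k y = r ∧ z = ∑ y ∈ T, ((k y : ℝ) / (r : ℝ)) • y

/-- `w = I_h g`: the member `w` of `V_h` is the Lagrange interpolant of `g` (a function vanishing
outside `Ω`), that is, `w` and `g` agree at all Lagrange nodes; at nodes outside `Ω` both vanish. -/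
def IsLagrangeInterpolant {d : ℕ} {Ω : Set (Pt d)} (𝒯 : Mesh Ω) (r : ℕ) (g : Pt d → ℝ)
    (w : femSpace 𝒯 r) : Prop :=
  ∀ z, IsNode 𝒯 r z → z ∈ Ω → (w : Pt d → ℝ) z = g z

/-! ### Local finite element spaces -/

/-- Restriction to `ω`; a function on `ω` is represented by its extension by `0` to `ℝ^d` (which
may be discontinuous across the boundary of `ω`). -/
def restrictFun {d : ℕ} (ω : Set (Pt d)) : (Pt d → ℝ) →ₗ[ℝ] (Pt d → ℝ) where
  toFun v := ω.indicator v
  map_add' u v := Set.indicator_add ω u v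
  map_smul' c v := Set.indicator_const_smul ω c v

/-- `V_h(ω) = {v|_ω : v ∈ V_h}`. -/
def localSpace {d : ℕ} {Ω : Set (Pt d)} (𝒯 : Mesh Ω) (r : ℕ) (ω : Set (Pt d)) :
    Submodule ℝ (Pt d → ℝ) :=
  (femSpace 𝒯 r).map (restrictFun ω)

/-- `V_{h,0}(ω)`: the members of `V_h` supported in the closure of `ω`. -/
def localSpaceZero {d : ℕ} {Ω : Set (Pt d)} (𝒯 : Mesh Ω) (r : ℕ) (ω : Set (Pt d)) :
    Submodule ℝ (femSpace 𝒯 r) where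
  carrier := {v | ∀ x, x ∉ closure ω → (v : Pt d → ℝ) x = 0}
  add_mem' := fun hu hv x hx => by simp [hu x hx, hv x hx]
  zero_mem' := fun _ _ => rfl
  smul_mem' := fun c _ hu x hx => by simp [hu x hx]

/-- The restriction `v ↦ v|_ω`, `V_h → V_h(ω)`. -/
def restrictGlobal {d : ℕ} {Ω : Set (Pt d)} (𝒯 : Mesh Ω) (r : ℕ) (ω : Set (Pt d)) :
    femSpace 𝒯 r →ₗ[ℝ] localSpace 𝒯 r ω :=
  (restrictFun ω).restrict fun _ hv => Submodule.mem_map_of_mem hv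

/-- The restriction `v ↦ v|_ω`, `V_h(ω') → V_h(ω)`, for `ω ⊆ ω'`. -/
def restrictLocal {d : ℕ} {Ω : Set (Pt d)} (𝒯 : Mesh Ω) (r : ℕ) {ω ω' : Set (Pt d)}
    (h : ω ⊆ ω') : localSpace 𝒯 r ω' →ₗ[ℝ] localSpace 𝒯 r ω :=
  (restrictFun ω).restrict (by
    rintro _ ⟨v, hv, rfl⟩
    refine ⟨v, hv, ?_⟩
    change ω.indicator v = ω.indicator (ω'.indicator v)
    rw [Set.indicator_indicator, Set.inter_eq_left.mpr h])

/-- The zero extension `V_{h,0}(ω) → V_{h,0}(ω')`, for `ω ⊆ ω'`. -/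
def extendZero {d : ℕ} {Ω : Set (Pt d)} (𝒯 : Mesh Ω) (r : ℕ) {ω ω' : Set (Pt d)}
    (h : ω ⊆ ω') : localSpaceZero 𝒯 r ω →ₗ[ℝ] localSpaceZero 𝒯 r ω' :=
  Submodule.inclusion fun _ hv x hx => hv x fun hx' => hx (closure_mono h hx')

/-- The `a`-harmonic space `V_{h,A}(ω) = {v ∈ V_h(ω) : a_ω(v, w) = 0 for all w ∈ V_{h,0}(ω)}`. -/
def harmonicSpace {d : ℕ} {Ω : Set (Pt d)} (A : Pt d → Matrix (Fin d) (Fin d) ℝ) (𝒯 : Mesh Ω)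
    (r : ℕ) (ω : Set (Pt d)) : Set (localSpace 𝒯 r ω) :=
  {v | ∀ w ∈ localSpaceZero 𝒯 r ω, energy A ω v w = 0}

/-! ### Overlapping decompositions and partitions of unity -/

/-- An overlapping decomposition `ω_i` of `Ω` with oversampling domains `ω_i^* ⊇ ω_i`, all of them
resolved by the mesh. -/
structure Decomposition {d : ℕ} {Ω : Set (Pt d)} (𝒯 : Mesh Ω) (M : ℕ) where
  dom : Fin M → Set (Pt d)
  ovs : Fin M → Set (Pt d)
  resolves_dom : ∀ i, 𝒯.Resolves (dom i)
  resolves_over : ∀ i, 𝒯.Resolves (ovs i)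
  dom_subset_over : ∀ i, dom i ⊆ ovs i
  cover : ⋃ i, dom i = Ω

/-- The maximal number of sets of the family that overlap at a point of `Ω`. -/
def overlapNumber {d M : ℕ} (Ω : Set (Pt d)) (ω : Fin M → Set (Pt d)) : ℕ :=
  sSup ((fun x => {i | x ∈ ω i}.ncard) '' Ω)

/-- A partition of unity on `Ω` subordinate to the `ω_i`. Only continuity of the functions is
asked for: Lipschitz bounds are not needed to define the interpolated operators below. -/
structure IsPartitionOfUnity {d : ℕ} {Ω : Set (Pt d)} {𝒯 : Mesh Ω} {M : ℕ}
    (D : Decomposition 𝒯 M) (χ : Fin M → Pt d → ℝ) : Prop where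
  continuousOn : ∀ i, ContinuousOn (χ i) Ω
  nonneg : ∀ i, ∀ x ∈ Ω, 0 ≤ χ i x
  le_one : ∀ i, ∀ x ∈ Ω, χ i x ≤ 1
  support_subset : ∀ i, ∀ x ∈ Ω, x ∉ closure (D.dom i) → χ i x = 0
  sum_eq_one : ∀ x ∈ Ω, ∑ i, χ i x = 1

/-- The partition of unity operator `χ_h : V_h(ω) → V_{h,0}(ω)`, `v ↦ I_h (χ v)`, i.e. the linear
map that sends `v` to the Lagrange interpolant of `χ v`. -/
def pouOp {d : ℕ} {Ω : Set (Pt d)} (𝒯 : Mesh Ω) (r : ℕ) (ω : Set (Pt d)) (χ : Pt d → ℝ) :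
    localSpace 𝒯 r ω →ₗ[ℝ] localSpaceZero 𝒯 r ω :=
  Classical.epsilon fun T : localSpace 𝒯 r ω →ₗ[ℝ] localSpaceZero 𝒯 r ω =>
    ∀ v : localSpace 𝒯 r ω,
      IsLagrangeInterpolant 𝒯 r (fun x => χ x * (v : Pt d → ℝ) x) (T v : femSpace 𝒯 r)

/-- `χ̃_{h,i} : V_{h,0}(ω_i^*) → V_{h,0}(ω_i^*)`, `v ↦ χ_{h,i}(v|_{ω_i})`. -/
def pouTilde {d : ℕ} {Ω : Set (Pt d)} {𝒯 : Mesh Ω} {M : ℕ} (r : ℕ) (D : Decomposition 𝒯 M)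
    (χ : Fin M → Pt d → ℝ) (i : Fin M) :
    localSpaceZero 𝒯 r (D.ovs i) →ₗ[ℝ] localSpaceZero 𝒯 r (D.ovs i) :=
  extendZero 𝒯 r (D.dom_subset_over i) ∘ₗ pouOp 𝒯 r (D.dom i) (χ i) ∘ₗ
    restrictGlobal 𝒯 r (D.dom i) ∘ₗ (localSpaceZero 𝒯 r (D.ovs i)).subtype

/-! ### Local eigenproblems and the coarse space -/

/-- `(lam, φ)`, `lam ∈ [0, ∞]`, solves
`a_{ω_i}(χ_{h,i}(φ|_{ω_i}), χ_{h,i}(v|_{ω_i})) = lam * a_{ω_i^*}(φ, v)` for all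
`v ∈ V_{h,A}(ω_i^*)`; for `lam = ∞` this means `a_{ω_i^*}(φ, v) = 0` for all such `v`. -/
def SolvesEigenproblem {d : ℕ} {Ω : Set (Pt d)} {𝒯 : Mesh Ω} {M : ℕ}
    (A : Pt d → Matrix (Fin d) (Fin d) ℝ) (r : ℕ) (D : Decomposition 𝒯 M)
    (χ : Fin M → Pt d → ℝ) (i : Fin M) (lam : ℝ≥0∞) (φ : localSpace 𝒯 r (D.ovs i)) : Prop :=
  ∀ v ∈ harmonicSpace A 𝒯 r (D.ovs i),
    if lam = ∞ then energy A (D.ovs i) φ v = 0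
    else energy A (D.dom i)
        (pouOp 𝒯 r (D.dom i) (χ i) (restrictLocal 𝒯 r (D.dom_subset_over i) φ) : femSpace 𝒯 r)
        (pouOp 𝒯 r (D.dom i) (χ i) (restrictLocal 𝒯 r (D.dom_subset_over i) v) : femSpace 𝒯 r)
      = lam.toReal * energy A (D.ovs i) φ v

/-- A complete system of eigenpairs of the `i`-th local eigenproblem: the `φ j` form a basis of
`V_{h,A}(ω_i^*)`, and the eigenvalues `lam j` are arranged in decreasing order. -/
structure IsEigensystem {d : ℕ} {Ω : Set (Pt d)} {𝒯 : Mesh Ω} {M : ℕ}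
    (A : Pt d → Matrix (Fin d) (Fin d) ℝ) (r : ℕ) (D : Decomposition 𝒯 M)
    (χ : Fin M → Pt d → ℝ) (i : Fin M) {N : ℕ} (lam : Fin N → ℝ≥0∞)
    (φ : Fin N → localSpace 𝒯 r (D.ovs i)) : Prop where
  linearIndependent : LinearIndependent ℝ φ
  span_eq : (Submodule.span ℝ (Set.range φ) : Set (localSpace 𝒯 r (D.ovs i)))
    = harmonicSpace A 𝒯 r (D.ovs i)
  antitone : Antitone lam
  solves : ∀ j, SolvesEigenproblem A r D χ i (lam j) (φ j)

/-- `S_{m_i}(ω_i)`: the span of the restrictions to `ω_i` of the first `m` eigenfunctions. -/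
def localApproxSpace {d : ℕ} {Ω : Set (Pt d)} {𝒯 : Mesh Ω} {M : ℕ} (r : ℕ)
    (D : Decomposition 𝒯 M) (i : Fin M) {N : ℕ} (φ : Fin N → localSpace 𝒯 r (D.ovs i)) (m : ℕ) :
    Submodule ℝ (localSpace 𝒯 r (D.dom i)) :=
  Submodule.span ℝ
    ((fun j => restrictLocal 𝒯 r (D.dom_subset_over i) (φ j)) '' {j : Fin N | (j : ℕ) < m})

/-- The coarse space `S_m(Ω) = {∑ i, χ_{h,i}(φ_i) : φ_i ∈ S_{m_i}(ω_i)}`. -/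
def coarseSpace {d : ℕ} {Ω : Set (Pt d)} {𝒯 : Mesh Ω} {M : ℕ} (r : ℕ)
    (D : Decomposition 𝒯 M) (χ : Fin M → Pt d → ℝ) {N : Fin M → ℕ}
    (φ : ∀ i, Fin (N i) → localSpace 𝒯 r (D.ovs i)) (m : Fin M → ℕ) :
    Submodule ℝ (femSpace 𝒯 r) :=
  ⨆ i, (localApproxSpace r D i (φ i) (m i)).map
    ((localSpaceZero 𝒯 r (D.dom i)).subtype ∘ₗ pouOp 𝒯 r (D.dom i) (χ i))

/-- The eigenvalue `λ_{m+1}` belonging to the first eigenfunction that is left out; it is `0` if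
all the eigenfunctions are used. -/
def nextEigenvalue {N : ℕ} (lam : Fin N → ℝ≥0∞) (m : ℕ) : ℝ≥0∞ :=
  if h : m < N then lam ⟨m, h⟩ else 0

/-- `Λ = (ξ ξ^* max_i λ_{i,m_i+1})^{1/2}`, as an element of `[0, ∞]`. -/
def errorBound {d : ℕ} {Ω : Set (Pt d)} {𝒯 : Mesh Ω} {M : ℕ} (D : Decomposition 𝒯 M)
    {N : Fin M → ℕ} (lam : ∀ i, Fin (N i) → ℝ≥0∞) (m : Fin M → ℕ) : ℝ≥0∞ :=
  ((overlapNumber Ω D.dom : ℝ≥0∞) * (overlapNumber Ω D.ovs : ℝ≥0∞) *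
    Finset.univ.sup fun i => nextEigenvalue (lam i) (m i)) ^ (1 / 2 : ℝ)

/-! ### Matrices -/

/-- The stiffness matrix `a(ψ_k, ψ_l)`. -/
def stiffness {d : ℕ} {Ω : Set (Pt d)} {𝒯 : Mesh Ω} {r n : ℕ}
    (A : Pt d → Matrix (Fin d) (Fin d) ℝ) (ψ : Module.Basis (Fin n) ℝ (femSpace 𝒯 r)) :
    Matrix (Fin n) (Fin n) ℝ :=
  Matrix.of fun k l => energy A Ω (ψ k : Pt d → ℝ) (ψ l : Pt d → ℝ)

/-- The matrix `R^T` of the embedding `W → V_h` of a subspace, with respect to bases. -/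
def embeddingMatrix {d : ℕ} {Ω : Set (Pt d)} {𝒯 : Mesh Ω} {r n s : ℕ}
    (ψ : Module.Basis (Fin n) ℝ (femSpace 𝒯 r)) {W : Submodule ℝ (femSpace 𝒯 r)}
    (e : Module.Basis (Fin s) ℝ W) : Matrix (Fin n) (Fin s) ℝ :=
  LinearMap.toMatrix e ψ W.subtype

/-- The one-level part `∑ i, R̃_i^T χ̃_i Ã_i⁻¹ R̃_i`, where `Ã_i = R̃_i A R̃_i^T`. -/
def oneLevel {d : ℕ} {Ω : Set (Pt d)} {𝒯 : Mesh Ω} {r n M : ℕ}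
    (A : Pt d → Matrix (Fin d) (Fin d) ℝ) (D : Decomposition 𝒯 M) (χ : Fin M → Pt d → ℝ)
    (ψ : Module.Basis (Fin n) ℝ (femSpace 𝒯 r)) {q : Fin M → ℕ}
    (e : ∀ i, Module.Basis (Fin (q i)) ℝ (localSpaceZero 𝒯 r (D.ovs i))) :
    Matrix (Fin n) (Fin n) ℝ :=
  ∑ i, embeddingMatrix ψ (e i) * LinearMap.toMatrix (e i) (e i) (pouTilde r D χ i) *
    ((embeddingMatrix ψ (e i))ᵀ * stiffness A ψ * embeddingMatrix ψ (e i))⁻¹ *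
    (embeddingMatrix ψ (e i))ᵀ

/-- The coarse part `R_S^T A_S⁻¹ R_S`, where `A_S = R_S A R_S^T`. -/
def coarseLevel {d : ℕ} {Ω : Set (Pt d)} {𝒯 : Mesh Ω} {r n s : ℕ}
    (A : Pt d → Matrix (Fin d) (Fin d) ℝ) (ψ : Module.Basis (Fin n) ℝ (femSpace 𝒯 r))
    {S : Submodule ℝ (femSpace 𝒯 r)} (eS : Module.Basis (Fin s) ℝ S) :
    Matrix (Fin n) (Fin n) ℝ :=
  embeddingMatrix ψ eS *
    ((embeddingMatrix ψ eS)ᵀ * stiffness A ψ * embeddingMatrix ψ eS)⁻¹ * (embeddingMatrix ψ eS)ᵀ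

/-- The two-level hybrid restricted additive Schwarz preconditioner
`B = B₁ + R_S^T A_S⁻¹ R_S (I - A B₁)`, where `B₁ = ∑ i, R̃_i^T χ̃_i Ã_i⁻¹ R̃_i`. -/
def preconditioner {d : ℕ} {Ω : Set (Pt d)} {𝒯 : Mesh Ω} {r n M s : ℕ}
    (A : Pt d → Matrix (Fin d) (Fin d) ℝ) (D : Decomposition 𝒯 M) (χ : Fin M → Pt d → ℝ)
    (ψ : Module.Basis (Fin n) ℝ (femSpace 𝒯 r)) {q : Fin M → ℕ}
    (e : ∀ i, Module.Basis (Fin (q i)) ℝ (localSpaceZero 𝒯 r (D.ovs i)))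
    {S : Submodule ℝ (femSpace 𝒯 r)} (eS : Module.Basis (Fin s) ℝ S) :
    Matrix (Fin n) (Fin n) ℝ :=
  oneLevel A D χ ψ e + coarseLevel A ψ eS * (1 - stiffness A ψ * oneLevel A D χ ψ e)

/-! ### GMRES -/

/-- `b` is an inner product on `ℝ^n`. -/
structure IsInnerProduct {n : ℕ} (b : LinearMap.BilinForm ℝ (Fin n → ℝ)) : Prop where
  symm : ∀ v w, b v w = b w v
  pos : ∀ v, v ≠ 0 → 0 < b v v

/-- The norm `‖v‖_b = √(b(v, v))`. -/
def bNorm {n : ℕ} (b : LinearMap.BilinForm ℝ (Fin n → ℝ)) (v : Fin n → ℝ) : ℝ := √(b v v)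

/-- The norm `‖v‖_a = √(vᵀ A v)`. -/
def aNorm {n : ℕ} (A : Matrix (Fin n) (Fin n) ℝ) (v : Fin n → ℝ) : ℝ := √(v ⬝ᵥ (A *ᵥ v))

/-- The Krylov space `span {C e, C² e, …, C^j e}`. -/
def krylov {n : ℕ} (C : Matrix (Fin n) (Fin n) ℝ) (e : Fin n → ℝ) (j : ℕ) :
    Submodule ℝ (Fin n → ℝ) :=
  Submodule.span ℝ {w | ∃ k, 1 ≤ k ∧ k ≤ j ∧ w = (C ^ k) *ᵥ e}

/-- The sequence `x 0, x 1, …` is generated by GMRES, with respect to the inner product `b`, for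
the system `C y = C u` with initial vector `x 0`: for `j ≥ 1`, `x j` minimizes the residual norm
`‖C (u - v)‖_b` over all `v ∈ x 0 + span {C (u - x 0), …, C^j (u - x 0)}`. -/
def IsGMRESSequence {n : ℕ} (b : LinearMap.BilinForm ℝ (Fin n → ℝ))
    (C : Matrix (Fin n) (Fin n) ℝ) (u : Fin n → ℝ) (x : ℕ → Fin n → ℝ) : Prop :=
  ∀ j, 1 ≤ j → x j - x 0 ∈ krylov C (u - x 0) j ∧
    ∀ v, v - x 0 ∈ krylov C (u - x 0) j →
      bNorm b (C *ᵥ (u - x j)) ≤ bNorm b (C *ᵥ (u - v))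

end MSGFEM

end

/-! The error propagation operator `1 - B * AA` is a contraction in the energy norm with factor `Λ`,
and GMRES is at least as good as the stationary iteration built from it.

Contraction (`energy_two_level_le`, in matrix form `aNorm_one_sub_preconditioner_le`). Let `v` be an
error and `p i` its energy projection onto `V_{h,0}(ω_i^*)`. Since the operators `localize` sum to
the identity (`sum_localize`), the one-level step turns `v` into the sum of the localizations of `v
- p i`. Each `v - p i` is discretely harmonic on `ω_i^*`, so it expands in the eigenfunctions.
Dropping those with eigenvalue at most `λ_{m+1}` costs at most that eigenvalue times the local
energy (`form_tail_le`, `exists_local_approx`). The localized leading parts lie in the coarse space,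
and the coarse correction is an energy projection, hence at least as good as subtracting them.
Summation over `i` contributes one overlap number in passing from a sum of local functions to its
energy (`energy_sum_le`) and the other in adding up the energies of `v` on the `ω_i^*`
(`sum_energy_le`).

GMRES (`gmres_bound`). The polynomial `(1 - t) ^ j` has value `1` at `0`, so it gives an admissible
competitor; its residual contracts by `Λ ^ j` in the energy norm, and two changes of norm cost `b₂ /
b₁`. The remaining factor `(1 + Λ) / (1 - Λ)` is at least `1` and is mere slack.

The finite element part supplies `sum_localize`. The partition of unity operators are introduced by
choice, so a linear Lagrange interpolation into `V_{h,0}(ω)` has to be constructed (`pouOp_spec`),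
and functions in `V_h` must be determined by their nodal values (`femSpace_ext`). Both rest on
products of falling factorials in the barycentric coordinates. The delicate point is that basis
functions of nodes in `Ω` vanish on the boundary (`mem_of_hat_pos`); this is where `interior
(closure Ω) = Ω` enters. -/

noncomputable section

namespace MSGFEM

/-! ### Barycentric coordinates -/

section Barycentric

variable {d : ℕ} {T : Finset (Pt d)}

/-- `T` is the vertex set of a `d`-simplex in `ℝ^d`. -/
def IsSimplex (T : Finset (Pt d)) : Prop :=
  AffineIndependent ℝ ((↑) : T → Pt d) ∧ T.card = d + 1

/-- The vertices of a `d`-simplex as an affine basis. -/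
def IsSimplex.affineBasis (hT : IsSimplex T) : AffineBasis T ℝ (Pt d) where
  toFun := (↑)
  ind' := hT.1
  tot' := by
    rw [hT.1.affineSpan_eq_top_iff_card_eq_finrank_add_one]
    simp [hT.2]

theorem IsSimplex.range_affineBasis (hT : IsSimplex T) :
    Set.range hT.affineBasis = (T : Set (Pt d)) :=
  Subtype.range_coe

open Classical in
/-- The barycentric coordinate of the vertex `y` of the simplex `T`; it is `0` if `y` is not a
vertex of `T`. -/
def baryCoord (T : Finset (Pt d)) (y : Pt d) : Pt d →ᵃ[ℝ] ℝ :=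
  if h : IsSimplex T ∧ y ∈ T then h.1.affineBasis.coord ⟨y, h.2⟩ else 0

theorem baryCoord_of_notMem {y : Pt d} (hy : y ∉ T) : baryCoord T y = 0 :=
  dif_neg fun h => hy h.2

theorem IsSimplex.baryCoord_coe (hT : IsSimplex T) (y : T) :
    baryCoord T (y : Pt d) = hT.affineBasis.coord y :=
  dif_pos ⟨hT, y.2⟩

theorem continuous_baryCoord (T : Finset (Pt d)) (y : Pt d) : Continuous (baryCoord T y) :=
  (baryCoord T y).continuous_of_finiteDimensional

theorem IsSimplex.sum_baryCoord (hT : IsSimplex T) (x : Pt d) : ∑ y ∈ T, baryCoord T y x = 1 := by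
  rw [← hT.affineBasis.sum_coord_apply_eq_one x, ← Finset.sum_coe_sort]
  exact Finset.sum_congr rfl fun y _ => by rw [hT.baryCoord_coe]

theorem IsSimplex.sum_baryCoord_smul (hT : IsSimplex T) (x : Pt d) :
    ∑ y ∈ T, baryCoord T y x • y = x := by
  conv_rhs => rw [← hT.affineBasis.linear_combination_coord_eq_self x]
  rw [← Finset.sum_coe_sort]
  exact Finset.sum_congr rfl fun y _ => by rw [hT.baryCoord_coe]; rfl

theorem IsSimplex.mem_convexHull_iff (hT : IsSimplex T) {x : Pt d} :
    x ∈ convexHull ℝ (T : Set (Pt d)) ↔ ∀ y ∈ T, 0 ≤ baryCoord T y x := by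
  rw [← hT.range_affineBasis, hT.affineBasis.convexHull_eq_nonneg_coord]
  simp only [Set.mem_ofPred_eq, Subtype.forall]
  exact forall₂_congr fun y hy => by rw [← hT.baryCoord_coe]

theorem IsSimplex.mem_interior_iff (hT : IsSimplex T) {x : Pt d} :
    x ∈ interior (convexHull ℝ (T : Set (Pt d))) ↔ ∀ y ∈ T, 0 < baryCoord T y x := by
  rw [← hT.range_affineBasis, hT.affineBasis.interior_convexHull]
  simp only [Set.mem_ofPred_eq, Subtype.forall]
  exact forall₂_congr fun y hy => by rw [← hT.baryCoord_coe]

theorem IsSimplex.baryCoord_nonneg (hT : IsSimplex T) {x : Pt d}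
    (hx : x ∈ convexHull ℝ (T : Set (Pt d))) (y : Pt d) : 0 ≤ baryCoord T y x := by
  by_cases hy : y ∈ T
  · exact hT.mem_convexHull_iff.1 hx y hy
  · simp [baryCoord_of_notMem hy]

theorem IsSimplex.baryCoord_vertex [DecidableEq (Pt d)] (hT : IsSimplex T) {y z : Pt d}
    (hz : z ∈ T) : baryCoord T y z = if y = z then 1 else 0 := by
  by_cases hy : y ∈ T
  · have : hT.affineBasis.coord ⟨y, hy⟩ z = if (⟨y, hy⟩ : T) = ⟨z, hz⟩ then 1 else 0 :=
      hT.affineBasis.coord_apply ⟨y, hy⟩ ⟨z, hz⟩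
    rw [← hT.baryCoord_coe] at this
    simpa only [Subtype.mk.injEq] using this
  · rw [baryCoord_of_notMem hy, if_neg (by rintro rfl; exact hy hz)]; rfl

theorem IsSimplex.baryCoord_sum (hT : IsSimplex T) {w : Pt d → ℝ} (h1 : ∑ y ∈ T, w y = 1)
    {y : Pt d} (hy : y ∈ T) : baryCoord T y (∑ z ∈ T, w z • z) = w y := by
  classical
  have h := T.map_affineCombination id w h1 (baryCoord T y)
  rw [T.affineCombination_eq_linear_combination _ _ h1,
    T.affineCombination_eq_linear_combination _ _ h1] at h
  simp only [id] at h
  rw [h, Finset.sum_congr rfl fun z hz => by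
    rw [Function.comp_apply, id, hT.baryCoord_vertex hz]]
  simp [hy]

theorem isCompact_convexHull_finset (T : Finset (Pt d)) :
    IsCompact (convexHull ℝ (T : Set (Pt d))) :=
  T.finite_toSet.isCompact_convexHull ℝ

theorem IsSimplex.subset_closure_interior (hT : IsSimplex T) :
    convexHull ℝ (T : Set (Pt d)) ⊆ closure (interior (convexHull ℝ (T : Set (Pt d)))) := by
  have hne : (interior (convexHull ℝ (T : Set (Pt d)))).Nonempty := by
    rw [← hT.range_affineBasis]
    exact interior_convexHull_nonempty_iff_affineSpan_eq_top.2 hT.affineBasis.tot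
  rw [(convex_convexHull ℝ _).closure_interior_eq_closure_of_nonempty_interior hne]
  exact subset_closure

end Barycentric

theorem sum_eq_sum_of_eq_zero {ι E : Type*} [AddCommMonoid E] {f : ι → E} {S T : Finset ι}
    (hS : ∀ i, i ∉ S → f i = 0) (hT : ∀ i, i ∉ T → f i = 0) : ∑ i ∈ S, f i = ∑ i ∈ T, f i := by
  classical
  rw [Finset.sum_subset Finset.subset_union_left fun i _ hi => hS i hi,
    Finset.sum_subset Finset.subset_union_right fun i _ hi => hT i hi]

/-! ### Meshes and hat functions -/

namespace Mesh

variable {d : ℕ} {Ω : Set (Pt d)} (𝒯 : Mesh Ω) {T T' : Finset (Pt d)}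

theorem isSimplex (hT : T ∈ 𝒯.elements) : IsSimplex T := ⟨𝒯.complex.indep hT.1, hT.2⟩

theorem finite_elements : 𝒯.elements.Finite := 𝒯.finite_faces.subset fun _ h => h.1

theorem exists_element {x : Pt d} (hx : x ∈ closure Ω) :
    ∃ T ∈ 𝒯.elements, x ∈ convexHull ℝ (T : Set (Pt d)) := by
  rw [← 𝒯.space_eq, Geometry.SimplicialComplex.mem_space_iff] at hx
  obtain ⟨s, hs, hxs⟩ := hx
  obtain ⟨T, hT, hsT, hc⟩ := 𝒯.pure s hs
  exact ⟨T, ⟨hT, hc⟩, convexHull_mono (Finset.coe_subset.2 hsT) hxs⟩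

theorem element_subset (hT : T ∈ 𝒯.elements) : convexHull ℝ (T : Set (Pt d)) ⊆ closure Ω := by
  rw [← 𝒯.space_eq]
  exact Geometry.SimplicialComplex.convexHull_subset_space hT.1

/-- In a simplicial complex a common point lies in the hull of the common vertices. Its weights
there, extended by zero, are its barycentric coordinates in both elements. This makes `hat`
independent of the chosen element. -/
theorem baryCoord_eq (hT : T ∈ 𝒯.elements) (hT' : T' ∈ 𝒯.elements) {x : Pt d}
    (hx : x ∈ convexHull ℝ (T : Set (Pt d))) (hx' : x ∈ convexHull ℝ (T' : Set (Pt d)))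
    (y : Pt d) : baryCoord T y x = baryCoord T' y x := by
  classical
  have key : ∀ {T T' : Finset (Pt d)}, T ∈ 𝒯.elements → T' ∈ 𝒯.elements →
      x ∈ convexHull ℝ (T : Set (Pt d)) → x ∈ convexHull ℝ (T' : Set (Pt d)) →
      ∃ w : Pt d → ℝ, (∀ z, z ∉ T ∩ T' → w z = 0) ∧ ∑ z ∈ T ∩ T', w z = 1 ∧
        ∑ z ∈ T ∩ T', w z • z = x := by
    intro T T' hT hT' hx hx'
    have h := 𝒯.complex.inter_subset_convexHull hT.1 hT'.1 ⟨hx, hx'⟩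
    rw [← Finset.coe_inter, Finset.mem_convexHull'] at h
    obtain ⟨w, -, hw1, hwx⟩ := h
    refine ⟨fun z => if z ∈ T ∩ T' then w z else 0, fun z hz => if_neg hz, ?_, ?_⟩
    · rw [← hw1]; exact Finset.sum_congr rfl fun z hz => if_pos hz
    · rw [← hwx]; exact Finset.sum_congr rfl fun z hz => by simp only [if_pos hz]
  obtain ⟨w, hw0, hw1, hwx⟩ := key hT hT' hx hx'
  have main : ∀ S ∈ 𝒯.elements, T ∩ T' ⊆ S → baryCoord S y x = w y := by
    intro S hS hsub
    have e1 : ∑ z ∈ S, w z = 1 := by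
      rw [← hw1]; exact (Finset.sum_subset hsub fun z _ hz => hw0 z hz).symm
    have e2 : ∑ z ∈ S, w z • z = x := by
      rw [← hwx]; exact (Finset.sum_subset hsub fun z _ hz => by rw [hw0 z hz, zero_smul]).symm
    by_cases hy : y ∈ S
    · have := (𝒯.isSimplex hS).baryCoord_sum e1 hy
      rwa [e2] at this
    · rw [baryCoord_of_notMem hy, hw0 y fun h => hy (hsub h)]; rfl
  rw [main T hT Finset.inter_subset_left, main T' hT' Finset.inter_subset_right]

open Classical in
/-- The piecewise affine hat function of the vertex `y` of the mesh, on `closure Ω`. -/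
def hat (y x : Pt d) : ℝ :=
  if h : ∃ T ∈ 𝒯.elements, x ∈ convexHull ℝ (T : Set (Pt d)) then baryCoord h.choose y x else 0

theorem hat_eq (hT : T ∈ 𝒯.elements) {x : Pt d} (hx : x ∈ convexHull ℝ (T : Set (Pt d)))
    (y : Pt d) : 𝒯.hat y x = baryCoord T y x := by
  have h : ∃ T ∈ 𝒯.elements, x ∈ convexHull ℝ (T : Set (Pt d)) := ⟨T, hT, hx⟩
  rw [hat, dif_pos h]
  exact 𝒯.baryCoord_eq h.choose_spec.1 hT h.choose_spec.2 hx y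

theorem hat_nonneg (y x : Pt d) : 0 ≤ 𝒯.hat y x := by
  by_cases h : ∃ T ∈ 𝒯.elements, x ∈ convexHull ℝ (T : Set (Pt d))
  · obtain ⟨T, hT, hx⟩ := h
    rw [𝒯.hat_eq hT hx]
    exact (𝒯.isSimplex hT).baryCoord_nonneg hx y
  · rw [hat, dif_neg h]

theorem mem_of_hat_ne_zero (hT : T ∈ 𝒯.elements) {x y : Pt d}
    (hx : x ∈ convexHull ℝ (T : Set (Pt d))) (h : 𝒯.hat y x ≠ 0) : y ∈ T := by
  by_contra hy
  rw [𝒯.hat_eq hT hx, baryCoord_of_notMem hy] at h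
  exact h rfl

/-- A point of the mesh lies in an element as soon as the element contains all the vertices that
have a nonzero weight at the point. -/
theorem mem_convexHull_of_hat (hT : T ∈ 𝒯.elements) {x : Pt d}
    (hx : x ∈ convexHull ℝ (T : Set (Pt d))) {S : Finset (Pt d)}
    (hS : ∀ y, 𝒯.hat y x ≠ 0 → y ∈ S) : x ∈ convexHull ℝ (S : Set (Pt d)) := by
  classical
  have hT' := 𝒯.isSimplex hT
  have h0 : ∀ y, y ∉ S → baryCoord T y x = 0 := fun y hy => by
    rw [← 𝒯.hat_eq hT hx]; exact not_not.1 fun h => hy (hS y h)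
  have h0' : ∀ y, y ∉ T → baryCoord T y x = 0 := fun y hy => by simp [baryCoord_of_notMem hy]
  refine Finset.mem_convexHull'.2 ⟨fun y => baryCoord T y x,
    fun y _ => hT'.baryCoord_nonneg hx y, ?_, ?_⟩
  · rw [← hT'.sum_baryCoord x]
    exact sum_eq_sum_of_eq_zero h0 h0'
  · conv_rhs => rw [← hT'.sum_baryCoord_smul x]
    exact sum_eq_sum_of_eq_zero (fun y hy => by simp only [h0 y hy, zero_smul])
      fun y hy => by simp only [h0' y hy, zero_smul]

/-- The open star of (the carrier of) a point of `Ω` is contained in `Ω`. -/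
theorem mem_of_hat_pos (hΩ : interior (closure Ω) = Ω) {z x : Pt d} (hz : z ∈ Ω)
    (hx : x ∈ closure Ω) (h : ∀ y, 𝒯.hat y z ≠ 0 → 𝒯.hat y x ≠ 0) : x ∈ Ω := by
  obtain ⟨T, hT, hxT⟩ := 𝒯.exists_element hx
  have hTs := 𝒯.isSimplex hT
  have hzT : z ∈ convexHull ℝ (T : Set (Pt d)) := by
    obtain ⟨S, hS, hzS⟩ := 𝒯.exists_element (subset_closure hz)
    exact 𝒯.mem_convexHull_of_hat hS hzS fun y hy => 𝒯.mem_of_hat_ne_zero hT hxT (h y hy)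
  have hΩo : IsOpen Ω := hΩ ▸ isOpen_interior
  -- Move from `z` slightly towards `x`. The new point `p` is still in `Ω`, but it has the same
  -- vertices of nonzero weight as `x`. The mesh near `x` is then compared with the mesh near `p` by
  -- translation.
  obtain ⟨t, ⟨ht0, ht1⟩, htΩ⟩ : ∃ t : ℝ, (0 < t ∧ t < 1) ∧ AffineMap.lineMap z x t ∈ Ω := by
    have hc : Continuous fun t : ℝ => AffineMap.lineMap z x t := AffineMap.lineMap_continuous
    have h1 : ∀ᶠ t in nhdsWithin (0 : ℝ) (Set.Ioi 0), AffineMap.lineMap z x t ∈ Ω :=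
      nhdsWithin_le_nhds (hc.continuousAt.eventually_mem (hΩo.mem_nhds (by simpa using hz)))
    have h2 : ∀ᶠ t in nhdsWithin (0 : ℝ) (Set.Ioi 0), 0 < t ∧ t < 1 :=
      Ioo_mem_nhdsGT one_pos
    exact (h2.and h1).exists
  set p : Pt d := AffineMap.lineMap z x t with hp
  have hpT : p ∈ convexHull ℝ (T : Set (Pt d)) :=
    (convex_convexHull ℝ _).lineMap_mem hzT hxT ⟨ht0.le, ht1.le⟩
  have hpx : ∀ y, 𝒯.hat y x = 0 → 𝒯.hat y p = 0 := by
    intro y hy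
    have hyz : 𝒯.hat y z = 0 := not_not.1 fun hne => h y hne hy
    rw [𝒯.hat_eq hT hpT, hp, AffineMap.apply_lineMap, ← 𝒯.hat_eq hT hxT, ← 𝒯.hat_eq hT hzT, hy,
      hyz, AffineMap.lineMap_same]
    rfl
  have hxp : ∀ y, 𝒯.hat y x ≠ 0 → 𝒯.hat y p ≠ 0 := by
    intro y hy
    rw [𝒯.hat_eq hT hpT, hp, AffineMap.apply_lineMap, ← 𝒯.hat_eq hT hxT, ← 𝒯.hat_eq hT hzT,
      AffineMap.lineMap_apply_module']
    have h1 := 𝒯.hat_nonneg y z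
    have h2 : 0 < 𝒯.hat y x := (𝒯.hat_nonneg y x).lt_of_ne' hy
    simp only [smul_eq_mul]
    nlinarith
  have e1 : ∀ᶠ v in nhds x, p + (v - x) ∈ Ω := by
    have hc : Continuous fun v : Pt d => p + (v - x) := by fun_prop
    exact hc.continuousAt.eventually_mem (hΩo.mem_nhds (by simpa using htΩ))
  have e2 : ∀ᶠ v in nhds x, ∀ S ∈ 𝒯.elements, p + (v - x) ∈ convexHull ℝ (S : Set (Pt d)) →
      p ∈ convexHull ℝ (S : Set (Pt d)) := by
    refine (Filter.eventually_all_finite 𝒯.finite_elements).2 fun S _ => ?_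
    by_cases hpS : p ∈ convexHull ℝ (S : Set (Pt d))
    · exact Filter.Eventually.of_forall fun _ _ => hpS
    · have hc : Continuous fun v : Pt d => p + (v - x) := by fun_prop
      have := hc.continuousAt.eventually_mem (x := x)
        ((isCompact_convexHull_finset S).isClosed.isOpen_compl.mem_nhds (by simpa using hpS))
      filter_upwards [this] with v hv hv'
      exact absurd hv' hv
  have e3 : ∀ᶠ v in nhds x, ∀ S ∈ 𝒯.elements, ∀ y ∈ S, 0 < baryCoord S y x →
      0 < baryCoord S y v := by
    refine (Filter.eventually_all_finite 𝒯.finite_elements).2 fun S _ => ?_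
    refine (Filter.eventually_all_finset S).2 fun y _ => ?_
    by_cases hy : 0 < baryCoord S y x
    · filter_upwards [(continuous_baryCoord S y).continuousAt.eventually_mem (Ioi_mem_nhds hy)]
        with v hv _ using hv
    · exact Filter.Eventually.of_forall fun _ h => absurd h hy
  rw [← hΩ, mem_interior_iff_mem_nhds]
  filter_upwards [e1, e2, e3] with v h1 h2 h3
  obtain ⟨S, hS, hvS⟩ := 𝒯.exists_element (subset_closure h1)
  have hpS := h2 S hS hvS
  have hSs := 𝒯.isSimplex hS
  have hxS : x ∈ convexHull ℝ (S : Set (Pt d)) :=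
    𝒯.mem_convexHull_of_hat hT hxT fun y hy => 𝒯.mem_of_hat_ne_zero hS hpS (hxp y hy)
  refine 𝒯.element_subset hS (hSs.mem_convexHull_iff.2 fun y hy => ?_)
  by_cases hyx : 𝒯.hat y x = 0
  -- This coordinate vanishes at both `p` and `x`, and it is affine, so it takes equal values at
  -- points displaced equally from `p` and from `x`. The remaining coordinates are positive at `x`
  -- and stay so nearby.
  · have hlin : baryCoord S y (p + (v - x)) = baryCoord S y v := by
      have a1 := (baryCoord S y).map_vadd p (v - x)
      have a2 := (baryCoord S y).map_vadd x (v - x)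
      rw [← 𝒯.hat_eq hS hpS, hpx y hyx] at a1
      rw [← 𝒯.hat_eq hS hxS, hyx] at a2
      simp only [vadd_eq_add] at a1 a2
      rw [add_comm p, a1, ← a2, sub_add_cancel]
    rw [← hlin]
    exact hSs.baryCoord_nonneg hvS y
  · refine (h3 S hS y hy ?_).le
    rw [← 𝒯.hat_eq hS hxS]
    exact (𝒯.hat_nonneg y x).lt_of_ne' hyx

/-- An element that does not belong to a family of elements does not meet the interior of the
union of the family. -/
theorem notMem_of_notMem {𝒮 : Set (Finset (Pt d))} (h𝒮 : 𝒮 ⊆ 𝒯.elements) (hT : T ∈ 𝒯.elements)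
    (hT𝒮 : T ∉ 𝒮) {x : Pt d} (hx : x ∈ convexHull ℝ (T : Set (Pt d))) :
    x ∉ interior (⋃ S ∈ 𝒮, convexHull ℝ (S : Set (Pt d))) := by
  intro hx'
  obtain ⟨p, hp, hpT⟩ := mem_closure_iff.1 ((𝒯.isSimplex hT).subset_closure_interior hx) _
    isOpen_interior hx'
  obtain ⟨S, hS, hpS⟩ := Set.mem_iUnion₂.1 (interior_subset hp)
  -- At `p`, an interior point of `T`, every vertex of `T` has positive weight, so each element
  -- containing `p` has all of them as vertices; equality follows by counting.
  have hsub : T ⊆ S := fun y hy => by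
    refine 𝒯.mem_of_hat_ne_zero (h𝒮 hS) hpS ?_
    rw [𝒯.hat_eq hT (interior_subset hpT)]
    exact ((𝒯.isSimplex hT).mem_interior_iff.1 hpT y hy).ne'
  exact hT𝒮 (Finset.eq_of_subset_of_card_le hsub (by rw [hT.2, (h𝒮 hS).2]) ▸ hS)

variable {𝒯}

theorem Resolves.isOpen {ω : Set (Pt d)} (h : 𝒯.Resolves ω) : IsOpen ω := by
  obtain ⟨𝒮, -, rfl⟩ := h
  exact isOpen_interior

theorem isClosed_biUnion {𝒮 : Set (Finset (Pt d))} (h𝒮 : 𝒮 ⊆ 𝒯.elements) :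
    IsClosed (⋃ S ∈ 𝒮, convexHull ℝ (S : Set (Pt d))) :=
  (𝒯.finite_elements.subset h𝒮).isClosed_biUnion fun S _ =>
    (isCompact_convexHull_finset S).isClosed

theorem Resolves.interior_closure {ω : Set (Pt d)} (h : 𝒯.Resolves ω) :
    interior (closure ω) = ω := by
  refine subset_antisymm ?_ (h.isOpen.subset_interior_iff.2 subset_closure)
  obtain ⟨𝒮, h𝒮, rfl⟩ := h
  exact interior_mono (closure_minimal interior_subset (isClosed_biUnion h𝒮))

theorem Resolves.subset {ω : Set (Pt d)} (h : 𝒯.Resolves ω) (hΩ : interior (closure Ω) = Ω) :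
    ω ⊆ Ω := by
  obtain ⟨𝒮, h𝒮, rfl⟩ := h
  conv_rhs => rw [← hΩ]
  exact interior_mono (Set.iUnion₂_subset fun S hS => 𝒯.element_subset (h𝒮 hS))

/-- An element is either contained in the closure of a resolved subdomain, or does not meet the
subdomain. -/
theorem Resolves.disjoint {ω : Set (Pt d)} (h : 𝒯.Resolves ω) (hT : T ∈ 𝒯.elements)
    {x : Pt d} (hx : x ∈ convexHull ℝ (T : Set (Pt d))) (hxω : x ∉ closure ω) :
    Disjoint (convexHull ℝ (T : Set (Pt d))) ω := by
  obtain ⟨𝒮, h𝒮, rfl⟩ := h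
  have hT𝒮 : T ∉ 𝒮 := fun hT𝒮 => hxω (closure_mono
    (interior_mono (Set.subset_biUnion_of_mem (u := fun S : Finset (Pt d) =>
      convexHull ℝ (S : Set (Pt d))) hT𝒮)) ((𝒯.isSimplex hT).subset_closure_interior hx))
  exact Set.disjoint_left.2 fun y hy => 𝒯.notMem_of_notMem h𝒮 hT hT𝒮 hy

end Mesh

/-! ### Lagrange interpolation on a simplex -/

section Unisolvence

variable {d : ℕ} {T : Finset (Pt d)}

/-- The Lagrange basis function of the multi-index `k` on the simplex `T`, up to normalization. -/
def lagrangeProd (T : Finset (Pt d)) (r : ℕ) (k : Pt d → ℕ) (x : Pt d) : ℝ :=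
  ∏ y ∈ T, (descPochhammer ℝ (k y)).eval ((r : ℝ) * baryCoord T y x)

/-- The span of the functions `lagrangeProd T r k` with `|k| = m`. -/
def lagrangeSpan (T : Finset (Pt d)) (r m : ℕ) : Submodule ℝ (Pt d → ℝ) :=
  Submodule.span ℝ (lagrangeProd T r '' (T.piAntidiag m : Set (Pt d → ℕ)))

/-- Raising `k y` by one multiplies the product by `r * baryCoord T y x - k y`. This recurrence
drives the spanning argument below. -/
theorem mul_lagrangeProd (r : ℕ) (k : Pt d → ℕ) {y : Pt d} (hy : y ∈ T)
    (x : Pt d) : (r : ℝ) * baryCoord T y x * lagrangeProd T r k x =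
      lagrangeProd T r (Function.update k y (k y + 1)) x + k y * lagrangeProd T r k x := by
  have h : ∏ z ∈ T.erase y, (descPochhammer ℝ (Function.update k y (k y + 1) z)).eval
        ((r : ℝ) * baryCoord T z x) =
      ∏ z ∈ T.erase y, (descPochhammer ℝ (k z)).eval ((r : ℝ) * baryCoord T z x) :=
    Finset.prod_congr rfl fun z hz => by
      rw [Function.update_of_ne (Finset.ne_of_mem_erase hz)]
  simp only [lagrangeProd]
  rw [← Finset.mul_prod_erase T _ hy, ← Finset.mul_prod_erase T (fun z =>
    (descPochhammer ℝ (Function.update k y (k y + 1) z)).eval ((r : ℝ) * baryCoord T z x)) hy, h,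
    Function.update_self, descPochhammer_succ_eval]
  ring

theorem update_mem_piAntidiag {k : Pt d → ℕ} {m : ℕ} (hk : k ∈ T.piAntidiag m) {y : Pt d}
    (hy : y ∈ T) : Function.update k y (k y + 1) ∈ T.piAntidiag (m + 1) := by
  rw [Finset.mem_piAntidiag] at hk ⊢
  refine ⟨?_, fun z hz => ?_⟩
  · have h1 : ∑ z ∈ T.erase y, Function.update k y (k y + 1) z = ∑ z ∈ T.erase y, k z :=
      Finset.sum_congr rfl fun z hz => by rw [Function.update_of_ne (Finset.ne_of_mem_erase hz)]
    have h2 := Finset.add_sum_erase T k hy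
    rw [← Finset.add_sum_erase T _ hy, h1, Function.update_self]
    rw [add_right_comm]
    exact congrArg (· + 1) (h2.trans hk.1)
  · by_cases hzy : z = y
    · rwa [hzy]
    · exact hk.2 z (by rwa [Function.update_of_ne hzy] at hz)

/-- Summing the recurrence over the vertices, with barycentric coordinates adding up to `1`, gives
`(r - m)` times the function as a sum of functions of degree `m + 1`. The factor is invertible
because `m < r`. -/
theorem lagrangeSpan_le_succ (hT : IsSimplex T) {r m : ℕ} (hm : m < r) :
    lagrangeSpan T r m ≤ lagrangeSpan T r (m + 1) := by
  refine Submodule.span_le.2 ?_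
  rintro _ ⟨k, hk, rfl⟩
  have hk' := (Finset.mem_piAntidiag.1 hk).1
  have hrm : (r : ℝ) - m ≠ 0 := sub_ne_zero.2 (by exact_mod_cast hm.ne')
  have key : lagrangeProd T r k =
      ((r : ℝ) - m)⁻¹ • ∑ y ∈ T, lagrangeProd T r (Function.update k y (k y + 1)) := by
    funext x
    have h : ∑ y ∈ T, (r : ℝ) * baryCoord T y x * lagrangeProd T r k x =
        ∑ y ∈ T, (lagrangeProd T r (Function.update k y (k y + 1)) x +
          k y * lagrangeProd T r k x) :=
      Finset.sum_congr rfl fun y hy => mul_lagrangeProd r k hy x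
    rw [← Finset.sum_mul, ← Finset.mul_sum, hT.sum_baryCoord, Finset.sum_add_distrib,
      ← Finset.sum_mul, ← Nat.cast_sum, hk'] at h
    rw [Pi.smul_apply, Finset.sum_apply, smul_eq_mul, eq_inv_mul_iff_mul_eq₀ hrm]
    linarith
  rw [key]
  exact Submodule.smul_mem _ _ (Submodule.sum_mem _ fun y hy =>
    Submodule.subset_span ⟨_, update_mem_piAntidiag hk hy, rfl⟩)

/-- A Cartesian coordinate is a linear combination of barycentric ones, and the recurrence says what
multiplication by those does. -/
theorem coord_mul_mem_lagrangeSpan (hT : IsSimplex T) {r m : ℕ} (hm : m < r) (i : Fin d)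
    {f : Pt d → ℝ} (hf : f ∈ lagrangeSpan T r m) :
    (fun x : Pt d => x i * f x) ∈ lagrangeSpan T r (m + 1) := by
  suffices h : lagrangeSpan T r m ≤
      (lagrangeSpan T r (m + 1)).comap (LinearMap.mulLeft ℝ fun x : Pt d => x i) from h hf
  refine Submodule.span_le.2 ?_
  rintro _ ⟨k, hk, rfl⟩
  have hr : (r : ℝ) ≠ 0 := by exact_mod_cast (Nat.zero_lt_of_lt hm).ne'
  have key : (fun x : Pt d => x i * lagrangeProd T r k x) =
      ∑ y ∈ T, (y i / r : ℝ) • (lagrangeProd T r (Function.update k y (k y + 1)) +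
        (k y : ℝ) • lagrangeProd T r k) := by
    funext x
    have hx : x i = ∑ y ∈ T, baryCoord T y x * y i := by
      conv_lhs => rw [← hT.sum_baryCoord_smul x]
      simp
    simp only [Finset.sum_apply, hx, Finset.sum_mul]
    refine Finset.sum_congr rfl fun y hy => ?_
    simp only [Pi.smul_apply, Pi.add_apply, smul_eq_mul, ← mul_lagrangeProd r k hy x]
    field_simp
  change (fun x : Pt d => x i * lagrangeProd T r k x) ∈ lagrangeSpan T r (m + 1)
  rw [key]
  refine Submodule.sum_mem _ fun y hy => Submodule.smul_mem _ _ (Submodule.add_mem _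
    (Submodule.subset_span ⟨_, update_mem_piAntidiag hk hy, rfl⟩) (Submodule.smul_mem _ _
      (lagrangeSpan_le_succ hT hm (Submodule.subset_span ⟨_, hk, rfl⟩))))

theorem monomial_mem_lagrangeSpan (hT : IsSimplex T) {r : ℕ} : ∀ {m : ℕ}, m ≤ r →
    ∀ a : Fin d → ℕ, ∑ i, a i ≤ m → (fun x : Pt d => ∏ i, x i ^ a i) ∈ lagrangeSpan T r m := by
  intro m
  induction m with
  | zero =>
    intro _ a ha
    have ha0 : ∀ i, a i = 0 := by simpa using ha
    refine Submodule.subset_span ⟨0, by simp, ?_⟩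
    funext x
    simp [lagrangeProd, ha0]
  | succ m ih =>
    intro hm a ha
    -- Only monomials of degree exactly `m + 1` are new; one coordinate is split off from them.
    by_cases h0 : ∑ i, a i ≤ m
    · exact lagrangeSpan_le_succ hT (by lia) (ih (by lia) a h0)
    obtain ⟨i, hi⟩ : ∃ i, a i ≠ 0 := by
      by_contra! h
      simp [h] at h0
    obtain ⟨c, hc⟩ := Nat.exists_eq_succ_of_ne_zero hi
    have hsum : ∑ j, Function.update a i c j ≤ m := by
      rw [← Finset.add_sum_erase _ _ (Finset.mem_univ i), Function.update_self,
        Finset.sum_congr rfl fun j hj => by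
          rw [Function.update_of_ne (Finset.ne_of_mem_erase hj)]]
      have := Finset.add_sum_erase Finset.univ a (Finset.mem_univ i)
      lia
    convert coord_mul_mem_lagrangeSpan hT (by lia) i (ih (by lia) _ hsum) using 2 with x
    rw [← Finset.mul_prod_erase _ _ (Finset.mem_univ i),
      ← Finset.mul_prod_erase _ (fun j => x j ^ Function.update a i c j) (Finset.mem_univ i),
      Function.update_self, hc, pow_succ', mul_assoc]
    congr 2
    exact Finset.prod_congr rfl fun j hj => by
      rw [Function.update_of_ne (Finset.ne_of_mem_erase hj)]

theorem eval_mem_lagrangeSpan (hT : IsSimplex T) {r : ℕ} {p : MvPolynomial (Fin d) ℝ}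
    (hp : p.totalDegree ≤ r) :
    (fun x : Pt d => MvPolynomial.eval (fun i => x i) p) ∈ lagrangeSpan T r r := by
  have : (fun x : Pt d => MvPolynomial.eval (fun i => x i) p) =
      ∑ a ∈ p.support, p.coeff a • fun x : Pt d => ∏ i, x i ^ a i := by
    funext x
    simp [MvPolynomial.eval_eq']
  rw [this]
  refine Submodule.sum_mem _ fun a ha => Submodule.smul_mem _ _
    (monomial_mem_lagrangeSpan hT le_rfl _ ?_)
  have := MvPolynomial.le_totalDegree ha
  rw [Finsupp.sum_fintype _ _ fun _ => rfl] at this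
  exact this.trans hp

theorem lagrangeProd_node (hT : IsSimplex T) {r : ℕ} (hr : r ≠ 0) (k l : Pt d → ℕ)
    (hl : ∑ y ∈ T, l y = r) :
    lagrangeProd T r k (∑ y ∈ T, ((l y : ℝ) / r) • y) =
      ∏ y ∈ T, ((l y).descFactorial (k y) : ℝ) := by
  have hr' : (r : ℝ) ≠ 0 := by exact_mod_cast hr
  refine Finset.prod_congr rfl fun y hy => ?_
  rw [hT.baryCoord_sum (w := fun y => (l y : ℝ) / r) _ hy, mul_div_cancel₀ _ hr',
    descPochhammer_eval_eq_descFactorial]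
  rw [← Finset.sum_div, ← Nat.cast_sum, hl, div_self hr']

/-- With equal sums, distinct multi-indices must satisfy `l y < k y` somewhere, and that falling
factorial is zero. Hence the basis functions are, up to normalization, dual to the nodes. -/
theorem prod_descFactorial_eq_zero {ι : Type*} {S : Finset ι} {k l : ι → ℕ}
    (h : ∑ y ∈ S, k y = ∑ y ∈ S, l y) (hkl : ∃ y ∈ S, k y ≠ l y) :
    ∏ y ∈ S, ((l y).descFactorial (k y) : ℝ) = 0 := by
  obtain ⟨y, hy, hlt⟩ : ∃ y ∈ S, l y < k y := by
    by_contra! hle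
    obtain ⟨y, hy, hne⟩ := hkl
    exact hne ((Finset.sum_eq_sum_iff_of_le hle).1 h y hy)
  exact Finset.prod_eq_zero hy (by rw [Nat.descFactorial_of_lt hlt, Nat.cast_zero])

/-- A polynomial of total degree at most `r` that vanishes at the Lagrange nodes of order `r` of a
simplex is zero. -/
theorem eval_eq_zero_of_nodes (hT : IsSimplex T) {r : ℕ} (hr : r ≠ 0)
    {p : MvPolynomial (Fin d) ℝ} (hp : p.totalDegree ≤ r)
    (h : ∀ l : Pt d → ℕ, ∑ y ∈ T, l y = r →
      MvPolynomial.eval (fun i => (∑ y ∈ T, ((l y : ℝ) / r) • y : Pt d) i) p = 0) (x : Pt d) :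
    MvPolynomial.eval (fun i => x i) p = 0 := by
  obtain ⟨c, hc⟩ := (Submodule.mem_span_image_finset_iff_exists_fun ℝ).1
    (eval_mem_lagrangeSpan hT hp)
  -- Evaluation at the node of `l` kills every term of the expansion except the one of index `l`,
  -- whose value is a nonzero product of factorials.
  have hc0 : ∀ l, c l = 0 := by
    intro l
    have hl' := Finset.mem_piAntidiag.1 l.2
    have h1 := congrFun hc (∑ y ∈ T, ((l.1 y : ℝ) / r) • y)
    rw [h l hl'.1, Finset.sum_apply, Finset.sum_eq_single_of_mem l (Finset.mem_univ l),
      Pi.smul_apply, lagrangeProd_node hT hr l l hl'.1, smul_eq_mul, mul_eq_zero] at h1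
    · refine h1.resolve_right (Finset.prod_ne_zero_iff.2 fun y _ => ?_)
      rw [Nat.descFactorial_self]
      exact_mod_cast (Nat.factorial_pos _).ne'
    · intro k _ hkl
      have hk' := Finset.mem_piAntidiag.1 k.2
      rw [Pi.smul_apply, lagrangeProd_node hT hr k l hl'.1,
        prod_descFactorial_eq_zero (hk'.1.trans hl'.1.symm), smul_zero]
      by_contra! hne
      refine hkl (Subtype.ext (funext fun y => ?_))
      by_cases hy : y ∈ T
      · exact hne y hy
      · rw [not_not.1 fun h0 => hy (hk'.2 y h0), not_not.1 fun h0 => hy (hl'.2 y h0)]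
  have h1 := congrFun hc x
  rw [← h1, Finset.sum_apply, Finset.sum_eq_zero fun k _ => by rw [hc0 k]; simp]

end Unisolvence

/-! ### Polynomial functions -/

section IsPolyOfDegree

variable {d : ℕ}

/-- `f` is a polynomial function of total degree at most `m`. -/
def IsPolyOfDegree (m : ℕ) (f : Pt d → ℝ) : Prop :=
  ∃ p : MvPolynomial (Fin d) ℝ, p.totalDegree ≤ m ∧
    ∀ x : Pt d, f x = MvPolynomial.eval (fun i => x i) p

theorem isPolyOfDegree_const (m : ℕ) (c : ℝ) : IsPolyOfDegree m fun _ : Pt d => c :=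
  ⟨MvPolynomial.C c, by simp, fun x => by simp⟩

theorem IsPolyOfDegree.add {m : ℕ} {f g : Pt d → ℝ} (hf : IsPolyOfDegree m f)
    (hg : IsPolyOfDegree m g) : IsPolyOfDegree m fun x => f x + g x := by
  obtain ⟨p, hp, hpe⟩ := hf
  obtain ⟨q, hq, hqe⟩ := hg
  exact ⟨p + q, (MvPolynomial.totalDegree_add p q).trans (max_le hp hq), fun x => by
    simp [hpe, hqe]⟩

theorem IsPolyOfDegree.mul {m n : ℕ} {f g : Pt d → ℝ} (hf : IsPolyOfDegree m f)
    (hg : IsPolyOfDegree n g) : IsPolyOfDegree (m + n) fun x => f x * g x := by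
  obtain ⟨p, hp, hpe⟩ := hf
  obtain ⟨q, hq, hqe⟩ := hg
  exact ⟨p * q, (MvPolynomial.totalDegree_mul p q).trans (add_le_add hp hq), fun x => by
    simp [hpe, hqe]⟩

theorem IsPolyOfDegree.const_mul {m : ℕ} {f : Pt d → ℝ} (hf : IsPolyOfDegree m f) (c : ℝ) :
    IsPolyOfDegree m fun x => c * f x := by
  simpa using (isPolyOfDegree_const 0 c).mul hf

theorem IsPolyOfDegree.sum {ι : Type*} {m : ℕ} (S : Finset ι) {f : ι → Pt d → ℝ}
    (hf : ∀ i ∈ S, IsPolyOfDegree m (f i)) : IsPolyOfDegree m fun x => ∑ i ∈ S, f i x := by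
  classical
  induction S using Finset.induction_on with
  | empty => simpa using isPolyOfDegree_const m 0
  | insert i S hi ih =>
    simp only [Finset.sum_insert hi]
    exact (hf i (Finset.mem_insert_self i S)).add
      (ih fun j hj => hf j (Finset.mem_insert_of_mem hj))

theorem IsPolyOfDegree.prod {ι : Type*} (S : Finset ι) {k : ι → ℕ} {f : ι → Pt d → ℝ}
    (hf : ∀ i ∈ S, IsPolyOfDegree (k i) (f i)) :
    IsPolyOfDegree (∑ i ∈ S, k i) fun x => ∏ i ∈ S, f i x := by
  classical
  induction S using Finset.induction_on with
  | empty => simpa using isPolyOfDegree_const 0 1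
  | insert i S hi ih =>
    simp only [Finset.sum_insert hi, Finset.prod_insert hi]
    exact (hf i (Finset.mem_insert_self i S)).mul
      (ih fun j hj => hf j (Finset.mem_insert_of_mem hj))

theorem isPolyOfDegree_affine (f : Pt d →ᵃ[ℝ] ℝ) : IsPolyOfDegree 1 f := by
  have hf : ∀ x : Pt d, f x = f 0 + ∑ i, f.linear (EuclideanSpace.single i 1) * x i := by
    intro x
    have h1 := f.map_vadd 0 x
    simp only [vadd_eq_add, add_zero] at h1
    have h2 : x = ∑ i, x i • EuclideanSpace.single i (1 : ℝ) := by
      ext j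
      simp [Finset.sum_apply, Pi.single_apply]
    rw [h1, add_comm]
    conv_lhs => rw [h2]
    rw [map_sum]
    simp [mul_comm]
  rw [show (f : Pt d → ℝ) = fun x => f x from rfl, funext hf]
  refine (isPolyOfDegree_const 1 _).add (IsPolyOfDegree.sum _ fun i _ => ?_)
  exact IsPolyOfDegree.const_mul ⟨MvPolynomial.X i, by simp, fun x => by simp⟩ _

theorem IsPolyOfDegree.descPochhammer {f : Pt d → ℝ} (hf : IsPolyOfDegree 1 f) (k : ℕ) :
    IsPolyOfDegree k fun x => (descPochhammer ℝ k).eval (f x) := by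
  induction k with
  | zero => simpa using isPolyOfDegree_const 0 1
  | succ k ih =>
    simp only [descPochhammer_succ_eval, sub_eq_add_neg]
    exact ih.mul (hf.add (isPolyOfDegree_const 1 _))

theorem IsPolyOfDegree.contDiff {m : ℕ} {f : Pt d → ℝ} (hf : IsPolyOfDegree m f) :
    ContDiff ℝ 1 f := by
  obtain ⟨p, -, hpe⟩ := hf
  rw [funext hpe]
  simp only [MvPolynomial.eval_eq']
  fun_prop

end IsPolyOfDegree

/-! ### Lagrange interpolation on a mesh -/

namespace Mesh

variable {d : ℕ} {Ω : Set (Pt d)} (𝒯 : Mesh Ω) {T : Finset (Pt d)}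

/-- The vertices of the elements of a mesh. -/
def vertexFinset : Finset (Pt d) := 𝒯.finite_elements.toFinset.biUnion id

theorem subset_vertexFinset (hT : T ∈ 𝒯.elements) : T ⊆ 𝒯.vertexFinset :=
  Finset.subset_biUnion_of_mem id (𝒯.finite_elements.mem_toFinset.2 hT)

/-- The point with barycentric coordinates `k y / r`. -/
def nodePoint (r : ℕ) (k : Pt d → ℕ) : Pt d := ∑ y ∈ 𝒯.vertexFinset, ((k y : ℝ) / r) • y

open Classical in
/-- The multi-indices of the Lagrange nodes that lie in `Ω`. -/
def nodeIndices (r : ℕ) : Finset (Pt d → ℕ) :=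
  (𝒯.vertexFinset.piAntidiag r).filter fun k =>
    (∃ T ∈ 𝒯.elements, ∀ y, k y ≠ 0 → y ∈ T) ∧ 𝒯.nodePoint r k ∈ Ω

theorem mem_nodeIndices {r : ℕ} {k : Pt d → ℕ} : k ∈ 𝒯.nodeIndices r ↔
    k ∈ 𝒯.vertexFinset.piAntidiag r ∧ (∃ T ∈ 𝒯.elements, ∀ y, k y ≠ 0 → y ∈ T) ∧
      𝒯.nodePoint r k ∈ Ω := by
  classical exact Finset.mem_filter

/-- The nodal basis function of the multi-index `k`, up to normalization, on `closure Ω`. -/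
def nodalFun (r : ℕ) (k : Pt d → ℕ) (x : Pt d) : ℝ :=
  ∏ y ∈ 𝒯.vertexFinset, (descPochhammer ℝ (k y)).eval ((r : ℝ) * 𝒯.hat y x)

theorem hat_ne_zero_of_nodalFun {r : ℕ} {k : Pt d → ℕ} {x : Pt d} (h : 𝒯.nodalFun r k x ≠ 0)
    {y : Pt d} (hy : y ∈ 𝒯.vertexFinset) (hk : k y ≠ 0) : 𝒯.hat y x ≠ 0 := by
  intro h0
  refine h (Finset.prod_eq_zero hy ?_)
  rw [h0, mul_zero, descPochhammer_eval_zero, if_neg hk]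

theorem hat_nodePoint {r : ℕ} (hr : r ≠ 0) {k : Pt d → ℕ} (hT : T ∈ 𝒯.elements)
    (hk : ∀ y, k y ≠ 0 → y ∈ T) (hsum : ∑ y ∈ T, k y = r) :
    𝒯.nodePoint r k ∈ convexHull ℝ (T : Set (Pt d)) ∧
      ∀ y, 𝒯.hat y (𝒯.nodePoint r k) = (k y : ℝ) / r := by
  have hr' : (r : ℝ) ≠ 0 := by exact_mod_cast hr
  have hs := 𝒯.isSimplex hT
  have hk0 : ∀ y, y ∉ T → k y = 0 := fun y hy => not_not.1 fun h => hy (hk y h)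
  have hz : 𝒯.nodePoint r k = ∑ y ∈ T, ((k y : ℝ) / r) • y :=
    (Finset.sum_subset (𝒯.subset_vertexFinset hT) fun y _ hy => by simp [hk0 y hy]).symm
  have h1 : ∑ y ∈ T, (k y : ℝ) / r = 1 := by
    rw [← Finset.sum_div, ← Nat.cast_sum, hsum, div_self hr']
  have hb : ∀ y, baryCoord T y (𝒯.nodePoint r k) = (k y : ℝ) / r := by
    intro y
    by_cases hy : y ∈ T
    · rw [hz]; exact hs.baryCoord_sum (w := fun y => (k y : ℝ) / r) h1 hy
    · rw [baryCoord_of_notMem hy, hk0 y hy]; simp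
  have hmem : 𝒯.nodePoint r k ∈ convexHull ℝ (T : Set (Pt d)) :=
    hs.mem_convexHull_iff.2 fun y _ => by rw [hb]; positivity
  exact ⟨hmem, fun y => by rw [𝒯.hat_eq hT hmem, hb]⟩

theorem hat_nodePoint_of_mem {r : ℕ} (hr : r ≠ 0) {k : Pt d → ℕ} (hk : k ∈ 𝒯.nodeIndices r)
    (y : Pt d) : 𝒯.hat y (𝒯.nodePoint r k) = (k y : ℝ) / r := by
  obtain ⟨hk1, ⟨T, hT, hkT⟩, -⟩ := 𝒯.mem_nodeIndices.1 hk
  refine (𝒯.hat_nodePoint hr hT hkT ?_).2 y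
  rw [← (Finset.mem_piAntidiag.1 hk1).1]
  exact Finset.sum_subset (𝒯.subset_vertexFinset hT) fun y _ hy => not_not.1 fun h => hy (hkT y h)

theorem nodePoint_mem_of_mem {r : ℕ} (hr : r ≠ 0) {k : Pt d → ℕ} (hk : k ∈ 𝒯.nodeIndices r)
    (hT : T ∈ 𝒯.elements) (hkT : ∀ y, k y ≠ 0 → y ∈ T) :
    𝒯.nodePoint r k ∈ convexHull ℝ (T : Set (Pt d)) := by
  refine (𝒯.hat_nodePoint hr hT hkT ?_).1
  rw [← (Finset.mem_piAntidiag.1 (𝒯.mem_nodeIndices.1 hk).1).1]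
  exact Finset.sum_subset (𝒯.subset_vertexFinset hT) fun y _ hy => not_not.1 fun h => hy (hkT y h)

/-- Where the function is nonzero, every vertex carrying the node has nonzero weight. Such a point
of `closure Ω` lies in the open star treated in `mem_of_hat_pos`, hence in `Ω`. -/
theorem nodalFun_eq_zero (hΩ : interior (closure Ω) = Ω) {r : ℕ} (hr : r ≠ 0) {k : Pt d → ℕ}
    (hk : k ∈ 𝒯.nodeIndices r) {x : Pt d} (hx : x ∈ closure Ω) (hxΩ : x ∉ Ω) :
    𝒯.nodalFun r k x = 0 := by
  by_contra hne
  obtain ⟨hk1, -, hkΩ⟩ := 𝒯.mem_nodeIndices.1 hk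
  refine hxΩ (𝒯.mem_of_hat_pos hΩ hkΩ hx fun y hy => ?_)
  have hky : k y ≠ 0 := by
    rintro h0
    rw [𝒯.hat_nodePoint_of_mem hr hk, h0] at hy
    simp at hy
  exact 𝒯.hat_ne_zero_of_nodalFun hne ((Finset.mem_piAntidiag.1 hk1).2 y hky) hky

theorem isPolyOfDegree_nodalFun {r : ℕ} {k : Pt d → ℕ} (hk : k ∈ 𝒯.nodeIndices r)
    (hT : T ∈ 𝒯.elements) : ∃ f : Pt d → ℝ, IsPolyOfDegree r f ∧
      ∀ x ∈ convexHull ℝ (T : Set (Pt d)), 𝒯.nodalFun r k x = f x := by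
  refine ⟨fun x => ∏ y ∈ 𝒯.vertexFinset, (descPochhammer ℝ (k y)).eval ((r : ℝ) *
    baryCoord T y x), ?_, fun x hx => Finset.prod_congr rfl fun y _ => by rw [𝒯.hat_eq hT hx]⟩
  have h := IsPolyOfDegree.prod 𝒯.vertexFinset fun y _ =>
    ((isPolyOfDegree_affine (baryCoord T y)).const_mul (r : ℝ)).descPochhammer (k y)
  rwa [(Finset.mem_piAntidiag.1 (𝒯.mem_nodeIndices.1 hk).1).1] at h

theorem continuousOn_nodalFun {r : ℕ} {k : Pt d → ℕ} (hk : k ∈ 𝒯.nodeIndices r) :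
    ContinuousOn (𝒯.nodalFun r k) (closure Ω) := by
  have := 𝒯.finite_elements.to_subtype
  have h : ContinuousOn (𝒯.nodalFun r k)
      (⋃ T : 𝒯.elements, convexHull ℝ ((T : Finset (Pt d)) : Set (Pt d))) := by
    refine (locallyFinite_of_finite _).continuousOn_iUnion
      (fun T => (isCompact_convexHull_finset _).isClosed) fun T => ?_
    obtain ⟨f, hf, hfe⟩ := 𝒯.isPolyOfDegree_nodalFun hk T.2
    exact hf.contDiff.continuous.continuousOn.congr hfe
  refine h.mono fun x hx => ?_
  obtain ⟨T, hT, hxT⟩ := 𝒯.exists_element hx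
  exact Set.mem_iUnion.2 ⟨⟨T, hT⟩, hxT⟩

theorem nodalFun_nodePoint {r : ℕ} (hr : r ≠ 0) {k l : Pt d → ℕ} (hl : l ∈ 𝒯.nodeIndices r) :
    𝒯.nodalFun r k (𝒯.nodePoint r l) =
      ∏ y ∈ 𝒯.vertexFinset, ((l y).descFactorial (k y) : ℝ) := by
  have hr' : (r : ℝ) ≠ 0 := by exact_mod_cast hr
  refine Finset.prod_congr rfl fun y _ => ?_
  rw [𝒯.hat_nodePoint_of_mem hr hl, mul_div_cancel₀ _ hr', descPochhammer_eval_eq_descFactorial]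

end Mesh

variable {d : ℕ} {Ω : Set (Pt d)} (𝒯 : Mesh Ω) {r : ℕ}

open Classical in
/-- The piecewise polynomial Lagrange interpolant of a function, extended by zero. -/
def interpFun (r : ℕ) (g : Pt d → ℝ) (x : Pt d) : ℝ :=
  if x ∈ Ω then ∑ k ∈ 𝒯.nodeIndices r, g (𝒯.nodePoint r k) *
    ((∏ y ∈ 𝒯.vertexFinset, ((k y).factorial : ℝ))⁻¹ * 𝒯.nodalFun r k x) else 0

theorem interpFun_of_mem_closure (hΩ : interior (closure Ω) = Ω) (hr : r ≠ 0) (g : Pt d → ℝ)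
    {x : Pt d} (hx : x ∈ closure Ω) :
    interpFun 𝒯 r g x = ∑ k ∈ 𝒯.nodeIndices r, g (𝒯.nodePoint r k) *
      ((∏ y ∈ 𝒯.vertexFinset, ((k y).factorial : ℝ))⁻¹ * 𝒯.nodalFun r k x) := by
  by_cases hxΩ : x ∈ Ω
  · rw [interpFun, if_pos hxΩ]
  · rw [interpFun, if_neg hxΩ, Finset.sum_eq_zero fun k hk => by
      rw [𝒯.nodalFun_eq_zero hΩ hr hk hx hxΩ, mul_zero, mul_zero]]

/-- Continuity is glued from the closed sets `closure Ω` and `Ωᶜ`. On their overlap, the boundary,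
the nodal sum is already zero. -/
theorem interpFun_mem (hΩ : interior (closure Ω) = Ω) (hr : r ≠ 0) (g : Pt d → ℝ) :
    interpFun 𝒯 r g ∈ femSpace 𝒯 r := by
  refine ⟨?_, fun x hx => if_neg hx, fun T hT => ?_⟩
  · have h1 : ContinuousOn (interpFun 𝒯 r g) (closure Ω) := by
      refine ContinuousOn.congr ?_ fun x hx => interpFun_of_mem_closure 𝒯 hΩ hr g hx
      exact continuousOn_finsetSum _ fun k hk => continuousOn_const.mul
        (continuousOn_const.mul (𝒯.continuousOn_nodalFun hk))
    have h2 : ContinuousOn (interpFun 𝒯 r g) Ωᶜ :=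
      continuousOn_const.congr (f := fun _ => (0 : ℝ)) fun x hx => if_neg hx
    have hΩo : IsOpen Ω := hΩ ▸ isOpen_interior
    have h3 := h1.union_of_isClosed h2 isClosed_closure hΩo.isClosed_compl
    rw [Set.eq_univ_of_subset (Set.union_subset_union_left _ subset_closure)
      (Set.union_compl_self Ω)] at h3
    exact continuousOn_univ.1 h3
  · choose f hf hfe using fun k : 𝒯.nodeIndices r => 𝒯.isPolyOfDegree_nodalFun k.2 hT
    obtain ⟨p, hp, hpe⟩ := IsPolyOfDegree.sum (𝒯.nodeIndices r).attach fun k _ =>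
      ((hf k).const_mul (∏ y ∈ 𝒯.vertexFinset, ((k.1 y).factorial : ℝ))⁻¹).const_mul
        (g (𝒯.nodePoint r k.1))
    refine ⟨p, hp, fun x hx => ?_⟩
    rw [← hpe, interpFun_of_mem_closure 𝒯 hΩ hr g (𝒯.element_subset hT hx),
      ← Finset.sum_attach]
    exact Finset.sum_congr rfl fun k _ => by rw [hfe k x hx]

/-- The Lagrange interpolation operator. -/
def interp (hΩ : interior (closure Ω) = Ω) (hr : r ≠ 0) : (Pt d → ℝ) →ₗ[ℝ] femSpace 𝒯 r where
  toFun g := ⟨interpFun 𝒯 r g, interpFun_mem 𝒯 hΩ hr g⟩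
  map_add' f g := by
    ext x
    change interpFun 𝒯 r (f + g) x = interpFun 𝒯 r f x + interpFun 𝒯 r g x
    by_cases hx : x ∈ Ω
    · simp [interpFun, hx, add_mul, Finset.sum_add_distrib]
    · simp [interpFun, hx]
  map_smul' c g := by
    ext x
    change interpFun 𝒯 r (c • g) x = c * interpFun 𝒯 r g x
    by_cases hx : x ∈ Ω
    · simp [interpFun, hx, mul_assoc, Finset.mul_sum]
    · simp [interpFun, hx]

/-- Every Lagrange node in `Ω` comes from a multi-index. -/
theorem exists_nodePoint {z : Pt d} (hz : IsNode 𝒯 r z) (hzΩ : z ∈ Ω) :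
    ∃ k ∈ 𝒯.nodeIndices r, 𝒯.nodePoint r k = z := by
  obtain ⟨T, hT, l, hl, rfl⟩ := hz
  have hk0 : ∀ y, (if y ∈ T then l y else 0) ≠ 0 → y ∈ T := fun y h => by
    by_contra hy
    exact h (if_neg hy)
  have hsum : ∀ {E : Type} [AddCommMonoid E] (f : ℕ → Pt d → E), (∀ y, f 0 y = 0) →
      ∑ y ∈ 𝒯.vertexFinset, f (if y ∈ T then l y else 0) y = ∑ y ∈ T, f (l y) y := by
    intro E _ f hf
    rw [← Finset.sum_subset (𝒯.subset_vertexFinset hT) fun y _ hy => by rw [if_neg hy, hf]]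
    exact Finset.sum_congr rfl fun y hy => by rw [if_pos hy]
  have hz : 𝒯.nodePoint r (fun y => if y ∈ T then l y else 0) =
      ∑ y ∈ T, ((l y : ℝ) / r) • y := hsum (fun a y => ((a : ℝ) / r) • y) (by simp)
  refine ⟨_, 𝒯.mem_nodeIndices.2 ⟨Finset.mem_piAntidiag.2
    ⟨(hsum (fun a _ => a) fun _ => rfl).trans hl, fun y hy =>
      𝒯.subset_vertexFinset hT (hk0 y hy)⟩, ⟨T, hT, hk0⟩, hz ▸ hzΩ⟩, hz⟩

theorem isLagrangeInterpolant_interp (hΩ : interior (closure Ω) = Ω) (hr : r ≠ 0)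
    (g : Pt d → ℝ) : IsLagrangeInterpolant 𝒯 r g (interp 𝒯 hΩ hr g) := by
  intro z hz hzΩ
  obtain ⟨l, hl, rfl⟩ := exists_nodePoint 𝒯 hz hzΩ
  change interpFun 𝒯 r g _ = _
  rw [interpFun, if_pos hzΩ, Finset.sum_eq_single_of_mem l hl]
  · rw [𝒯.nodalFun_nodePoint hr hl]
    simp only [Nat.descFactorial_self]
    rw [inv_mul_cancel₀, mul_one]
    exact Finset.prod_ne_zero_iff.2 fun y _ => by exact_mod_cast (Nat.factorial_pos _).ne'
  · intro k hk hkl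
    have hk1 := Finset.mem_piAntidiag.1 (𝒯.mem_nodeIndices.1 hk).1
    have hl1 := Finset.mem_piAntidiag.1 (𝒯.mem_nodeIndices.1 hl).1
    rw [𝒯.nodalFun_nodePoint hr hl, prod_descFactorial_eq_zero (hk1.1.trans hl1.1.symm), mul_zero,
      mul_zero]
    by_contra! hne
    refine hkl (funext fun y => ?_)
    by_cases hy : y ∈ 𝒯.vertexFinset
    · exact hne y hy
    · rw [not_not.1 fun h0 => hy (hk1.2 y h0), not_not.1 fun h0 => hy (hl1.2 y h0)]

/-- Only nodes of the element containing a point contribute there, and an element with a point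
outside `closure ω` does not meet `ω`, where `g` has its support. -/
theorem interp_mem_localSpaceZero (hΩ : interior (closure Ω) = Ω) (hr : r ≠ 0) {ω : Set (Pt d)}
    (hω : 𝒯.Resolves ω) {g : Pt d → ℝ} (hg : ∀ x, x ∉ ω → g x = 0) :
    interp 𝒯 hΩ hr g ∈ localSpaceZero 𝒯 r ω := by
  intro x hx
  change interpFun 𝒯 r g x = 0
  by_cases hxΩ : x ∈ Ω
  · obtain ⟨T, hT, hxT⟩ := 𝒯.exists_element (subset_closure hxΩ)
    rw [interpFun, if_pos hxΩ]
    refine Finset.sum_eq_zero fun k hk => ?_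
    by_cases h0 : 𝒯.nodalFun r k x = 0
    · rw [h0, mul_zero, mul_zero]
    · rw [hg, zero_mul]
      have hk1 := Finset.mem_piAntidiag.1 (𝒯.mem_nodeIndices.1 hk).1
      exact Set.disjoint_left.1 (hω.disjoint hT hxT hx) (𝒯.nodePoint_mem_of_mem hr hk hT fun y hy =>
        𝒯.mem_of_hat_ne_zero hT hxT (𝒯.hat_ne_zero_of_nodalFun h0 (hk1.2 y hy) hy))
  · exact if_neg hxΩ

/-- A finite element function is determined by its values at the Lagrange nodes in `Ω`. -/
theorem femSpace_ext (hr : r ≠ 0) {v w : femSpace 𝒯 r}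
    (h : ∀ z, IsNode 𝒯 r z → z ∈ Ω → (v : Pt d → ℝ) z = (w : Pt d → ℝ) z) : v = w := by
  ext x
  by_cases hx : x ∈ Ω
  · obtain ⟨T, hT, hxT⟩ := 𝒯.exists_element (subset_closure hx)
    have hs := 𝒯.isSimplex hT
    obtain ⟨p, hp, hpe⟩ := v.2.2.2 T hT
    obtain ⟨q, hq, hqe⟩ := w.2.2.2 T hT
    have key := eval_eq_zero_of_nodes hs hr (p := p - q)
      ((MvPolynomial.totalDegree_sub p q).trans (max_le hp hq)) (fun l hl => ?_) x
    · rw [map_sub, sub_eq_zero] at key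
      rw [hpe x hxT, hqe x hxT, key]
    · have hr' : (r : ℝ) ≠ 0 := by exact_mod_cast hr
      have hmem : ∑ y ∈ T, ((l y : ℝ) / r) • y ∈ convexHull ℝ (T : Set (Pt d)) := by
        refine Finset.mem_convexHull'.2 ⟨fun y => (l y : ℝ) / r, fun y _ => by positivity, ?_, rfl⟩
        rw [← Finset.sum_div, ← Nat.cast_sum, hl, div_self hr']
      rw [map_sub, ← hpe _ hmem, ← hqe _ hmem, sub_eq_zero]
      by_cases hz : ∑ y ∈ T, ((l y : ℝ) / r) • y ∈ Ω
      · exact h _ ⟨T, hT, l, hl, rfl⟩ hz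
      · rw [v.2.2.1 _ hz, w.2.2.1 _ hz]
  · rw [v.2.2.1 x hx, w.2.2.1 x hx]

/-! ### The partition of unity operators -/

theorem localSpace_eq_zero {ω : Set (Pt d)} (v : localSpace 𝒯 r ω) {x : Pt d} (hx : x ∉ ω) :
    (v : Pt d → ℝ) x = 0 := by
  obtain ⟨v, u, -, rfl⟩ := v
  exact Set.indicator_of_notMem hx u

/-- `pouOp` is a choice among linear maps with the interpolation property, so it has that property
only once such a map is exhibited. -/
theorem pouOp_spec (hΩ : interior (closure Ω) = Ω) (hr : r ≠ 0) {ω : Set (Pt d)}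
    (hω : 𝒯.Resolves ω) (χ : Pt d → ℝ) (v : localSpace 𝒯 r ω) :
    IsLagrangeInterpolant 𝒯 r (fun x => χ x * (v : Pt d → ℝ) x)
      (pouOp 𝒯 r ω χ v : femSpace 𝒯 r) := by
  have hex : ∃ S : localSpace 𝒯 r ω →ₗ[ℝ] localSpaceZero 𝒯 r ω, ∀ v : localSpace 𝒯 r ω,
      IsLagrangeInterpolant 𝒯 r (fun x => χ x * (v : Pt d → ℝ) x) (S v : femSpace 𝒯 r) := by
    refine ⟨LinearMap.codRestrict _ (interp 𝒯 hΩ hr ∘ₗ LinearMap.mulLeft ℝ χ ∘ₗ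
      (localSpace 𝒯 r ω).subtype) fun v => ?_, fun v => ?_⟩
    · exact interp_mem_localSpaceZero 𝒯 hΩ hr hω fun x hx => by
        simp [localSpace_eq_zero 𝒯 v hx]
    · exact isLagrangeInterpolant_interp 𝒯 hΩ hr _
  exact Classical.epsilon_spec hex v

variable {𝒯} {M : ℕ} {D : Decomposition 𝒯 M} {χ : Fin M → Pt d → ℝ}

/-- The assumption gives zero only off `closure (D.dom i)`. As `D.dom i` is the interior of its
closure, the other points of `Ω` outside it are limits of such points, and `χ i` is continuous. This
matters at nodes on the boundary of a subdomain, where restrictions are represented by `0`. -/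
theorem IsPartitionOfUnity.eq_zero (hχ : IsPartitionOfUnity D χ)
    (hΩ : interior (closure Ω) = Ω) (i : Fin M) {x : Pt d} (hx : x ∈ Ω) (hxi : x ∉ D.dom i) :
    χ i x = 0 := by
  have hΩo : IsOpen Ω := hΩ ▸ isOpen_interior
  have hx' : x ∈ closure (Ω ∩ (closure (D.dom i))ᶜ) := by
    refine hΩo.inter_closure ⟨hx, ?_⟩
    rwa [closure_compl, (D.resolves_dom i).interior_closure]
  have hc : ContinuousWithinAt (χ i) (Ω ∩ (closure (D.dom i))ᶜ) x :=
    (hχ.continuousOn i x hx).mono Set.inter_subset_left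
  have hmem : χ i x ∈ closure ({0} : Set ℝ) :=
    hc.mem_closure hx' fun y hy => hχ.support_subset i y hy.1 hy.2
  simpa using hmem

/-- The localization `v ↦ χ_{h,i}(v|_{ω_i})` as an endomorphism of the finite element space. -/
def localize (r : ℕ) (D : Decomposition 𝒯 M) (χ : Fin M → Pt d → ℝ) (i : Fin M) :
    femSpace 𝒯 r →ₗ[ℝ] femSpace 𝒯 r :=
  (localSpaceZero 𝒯 r (D.dom i)).subtype ∘ₗ pouOp 𝒯 r (D.dom i) (χ i) ∘ₗ
    restrictGlobal 𝒯 r (D.dom i)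

theorem localize_mem (i : Fin M) (v : femSpace 𝒯 r) :
    localize r D χ i v ∈ localSpaceZero 𝒯 r (D.dom i) :=
  (pouOp 𝒯 r (D.dom i) (χ i) (restrictGlobal 𝒯 r (D.dom i) v)).2

theorem sum_localize (hχ : IsPartitionOfUnity D χ) (hΩ : interior (closure Ω) = Ω) (hr : r ≠ 0)
    (v : femSpace 𝒯 r) : ∑ i, localize r D χ i v = v := by
  refine femSpace_ext 𝒯 hr fun z hz hzΩ => ?_
  have h : ∀ i, (localize r D χ i v : Pt d → ℝ) z = χ i z * (v : Pt d → ℝ) z := by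
    intro i
    refine (pouOp_spec 𝒯 hΩ hr (D.resolves_dom i) (χ i) (restrictGlobal 𝒯 r (D.dom i) v)
      z hz hzΩ).trans ?_
    change χ i z * (D.dom i).indicator v z = _
    by_cases hzi : z ∈ D.dom i
    · rw [Set.indicator_of_mem hzi]
    · rw [hχ.eq_zero hΩ i hzΩ hzi, zero_mul, zero_mul]
  rw [AddSubmonoidClass.coe_finsetSum, Finset.sum_apply, Finset.sum_congr rfl fun i _ => h i,
    ← Finset.sum_mul, hχ.sum_eq_one z hzΩ, one_mul]

/-! ### Positive semidefinite bilinear forms -/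

section Forms

variable {V : Type*} [AddCommGroup V] [Module ℝ V]

/-- Expand the form at `v - w`. Keeping both mixed terms avoids any symmetry assumption. -/
theorem add_le_of_nonneg {B : LinearMap.BilinForm ℝ V} (hB : ∀ v, 0 ≤ B v v) (v w : V) :
    B v w + B w v ≤ B v v + B w w := by
  have := hB (v - w)
  simp only [map_sub, LinearMap.sub_apply] at this
  linarith

theorem abs_add_le_of_nonneg {B : LinearMap.BilinForm ℝ V} (hB : ∀ v, 0 ≤ B v v) (v w : V) :
    |B v w + B w v| ≤ B v v + B w w := by
  refine abs_le.2 ⟨?_, add_le_of_nonneg hB v w⟩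
  have := hB (v + w)
  simp only [map_add, LinearMap.add_apply] at this
  linarith

theorem form_add_self {B : LinearMap.BilinForm ℝ V} {v w : V} (h : B v w = 0) (h' : B w v = 0) :
    B (v + w) (v + w) = B v v + B w w := by
  simp only [map_add, LinearMap.add_apply, h, h']
  ring

theorem form_sum_le {ι : Type*} {B : LinearMap.BilinForm ℝ V} (hB : ∀ v, 0 ≤ B v v)
    (s : Finset ι) (g : ι → V) :
    B (∑ i ∈ s, g i) (∑ i ∈ s, g i) ≤ s.card * ∑ i ∈ s, B (g i) (g i) := by
  have h1 : B (∑ i ∈ s, g i) (∑ i ∈ s, g i) = ∑ i ∈ s, ∑ j ∈ s, B (g i) (g j) := by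
    simp only [map_sum, LinearMap.sum_apply]
    exact Finset.sum_comm
  have h2 : ∑ i ∈ s, ∑ j ∈ s, (B (g i) (g j) + B (g j) (g i)) ≤
      ∑ i ∈ s, ∑ j ∈ s, (B (g i) (g i) + B (g j) (g j)) :=
    Finset.sum_le_sum fun i _ => Finset.sum_le_sum fun j _ => add_le_of_nonneg hB _ _
  simp only [Finset.sum_add_distrib, Finset.sum_const, nsmul_eq_mul] at h2
  rw [Finset.sum_comm (f := fun i j => B (g j) (g i)), ← Finset.mul_sum] at h2
  rw [h1]
  linarith

end Forms

/-! ### Gradients of finite element functions -/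

section Gradients

variable {d : ℕ} {Ω : Set (Pt d)} {𝒯 : Mesh Ω} {r : ℕ} {T : Finset (Pt d)}

theorem ae_notMem_frontier (𝒯 : Mesh Ω) : ∀ᵐ x : Pt d, ∀ T ∈ 𝒯.elements,
    x ∉ frontier (convexHull ℝ (T : Set (Pt d))) :=
  (ae_ball_iff 𝒯.finite_elements.countable).2 fun _ _ =>
    measure_eq_zero_iff_ae_notMem.1 ((convex_convexHull ℝ _).addHaar_frontier volume)

theorem mem_interior_of_notMem_frontier {s : Set (Pt d)} {x : Pt d} (hx : x ∈ s)
    (h : x ∉ frontier s) : x ∈ interior s := by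
  by_contra hi
  exact h ⟨subset_closure hx, hi⟩

theorem ae_mem_interior (𝒯 : Mesh Ω) : ∀ᵐ x : Pt d, x ∈ Ω → ∃ T ∈ 𝒯.elements,
    x ∈ interior (convexHull ℝ (T : Set (Pt d))) := by
  filter_upwards [ae_notMem_frontier 𝒯] with x hx hxΩ
  obtain ⟨T, hT, hxT⟩ := 𝒯.exists_element (subset_closure hxΩ)
  exact ⟨T, hT, mem_interior_of_notMem_frontier hxT (hx T hT)⟩

theorem exists_contDiff (v : femSpace 𝒯 r) (hT : T ∈ 𝒯.elements) : ∃ f : Pt d → ℝ,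
    ContDiff ℝ 1 f ∧ ∀ x ∈ interior (convexHull ℝ (T : Set (Pt d))), (v : Pt d → ℝ) =ᶠ[nhds x] f := by
  obtain ⟨p, hp, hpe⟩ := v.2.2.2 T hT
  refine ⟨fun x => MvPolynomial.eval (fun k => x k) p,
    IsPolyOfDegree.contDiff ⟨p, hp, fun _ => rfl⟩, fun x hx => ?_⟩
  filter_upwards [mem_interior_iff_mem_nhds.1 hx] with y hy using hpe y hy

theorem ae_differentiableAt (v : femSpace 𝒯 r) :
    ∀ᵐ x : Pt d, x ∈ Ω → DifferentiableAt ℝ (v : Pt d → ℝ) x := by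
  filter_upwards [ae_mem_interior 𝒯] with x hx hxΩ
  obtain ⟨T, hT, hxT⟩ := hx hxΩ
  obtain ⟨f, hf, hvf⟩ := exists_contDiff v hT
  exact ((hf.differentiable one_ne_zero) x).congr_of_eventuallyEq (hvf x hxT)

theorem gradient_congr {f g : Pt d → ℝ} {x : Pt d} (h : f =ᶠ[nhds x] g) :
    gradient f x = gradient g x := by
  rw [gradient, gradient, h.fderiv_eq]

/-- On each of the finitely many compact elements the gradient is that of a polynomial. The bound
makes the energy integrands integrable. -/
theorem exists_gradient_bound (v : femSpace 𝒯 r) :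
    ∃ C : ℝ, ∀ᵐ x : Pt d, x ∈ Ω → ‖gradient (v : Pt d → ℝ) x‖ ≤ C := by
  have h : ∀ T ∈ 𝒯.elements, ∃ C : ℝ, ∀ x ∈ interior (convexHull ℝ (T : Set (Pt d))),
      ‖gradient (v : Pt d → ℝ) x‖ ≤ C := by
    intro T hT
    obtain ⟨f, hf, hvf⟩ := exists_contDiff v hT
    obtain ⟨C, hC⟩ := (isCompact_convexHull_finset T).exists_bound_of_continuousOn
      (hf.continuous_fderiv one_ne_zero).continuousOn
    refine ⟨C, fun x hx => ?_⟩
    rw [gradient_congr (hvf x hx), gradient, LinearIsometryEquiv.norm_map]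
    exact hC x (interior_subset hx)
  choose! C hC using h
  obtain ⟨C', hC'⟩ := (𝒯.finite_elements.image C).bddAbove
  refine ⟨C', ?_⟩
  filter_upwards [ae_mem_interior 𝒯] with x hx hxΩ
  obtain ⟨T, hT, hxT⟩ := hx hxΩ
  exact (hC T hT x hxT).trans (hC' (Set.mem_image_of_mem C hT))

theorem measurable_gradient (f : Pt d → ℝ) : Measurable (gradient f) :=
  (InnerProductSpace.toDual ℝ (Pt d)).symm.continuous.measurable.comp (measurable_fderiv ℝ f)

theorem ae_gradient_add (u v : femSpace 𝒯 r) : ∀ᵐ x : Pt d, x ∈ Ω →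
    gradient ((u + v : femSpace 𝒯 r) : Pt d → ℝ) x =
      gradient (u : Pt d → ℝ) x + gradient (v : Pt d → ℝ) x := by
  filter_upwards [ae_differentiableAt u, ae_differentiableAt v] with x hu hv hx
  rw [gradient, gradient, gradient, ← map_add, ← fderiv_add (hu hx) (hv hx)]
  rfl

theorem ae_gradient_smul (c : ℝ) (v : femSpace 𝒯 r) : ∀ᵐ x : Pt d, x ∈ Ω →
    gradient ((c • v : femSpace 𝒯 r) : Pt d → ℝ) x = c • gradient (v : Pt d → ℝ) x := by
  filter_upwards [ae_differentiableAt v] with x hv hx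
  have : fderiv ℝ (c • (v : Pt d → ℝ)) x = c • fderiv ℝ (v : Pt d → ℝ) x :=
    fderiv_const_smul (hv hx) c
  rw [gradient, gradient, ← (InnerProductSpace.toDual ℝ (Pt d)).symm.map_smul, Submodule.coe_smul,
    this]

theorem ae_gradient_sum {ι : Type*} (s : Finset ι) (f : ι → femSpace 𝒯 r) :
    ∀ᵐ x : Pt d, x ∈ Ω → gradient ((∑ i ∈ s, f i : femSpace 𝒯 r) : Pt d → ℝ) x =
      ∑ i ∈ s, gradient (f i : Pt d → ℝ) x := by
  classical
  induction s using Finset.induction_on with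
  | empty =>
    refine Filter.Eventually.of_forall fun x _ => ?_
    have : fderiv ℝ (0 : Pt d → ℝ) x = 0 := by simp
    rw [Finset.sum_empty, Finset.sum_empty, Submodule.coe_zero, gradient, this, map_zero]
  | insert i s hi ih =>
    filter_upwards [ih, ae_gradient_add (f i) (∑ i ∈ s, f i)] with x h1 h2 hx
    rw [Finset.sum_insert hi, Finset.sum_insert hi, h2 hx, h1 hx]

/-- The gradient of a member of `V_{h,0}(ω)` vanishes almost everywhere outside `ω`. -/
theorem ae_gradient_eq_zero {ω : Set (Pt d)} (hω : 𝒯.Resolves ω) {w : femSpace 𝒯 r}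
    (hw : w ∈ localSpaceZero 𝒯 r ω) :
    ∀ᵐ x : Pt d, x ∉ ω → gradient (w : Pt d → ℝ) x = 0 := by
  filter_upwards [ae_notMem_frontier 𝒯] with x hx hxω
  -- Off the element boundaries, a point of `closure ω` is interior to an element of the family,
  -- hence belongs to `ω`.
  have hxc : x ∉ closure ω := by
    obtain ⟨𝒮, h𝒮, rfl⟩ := hω
    intro hxc
    obtain ⟨T, hT, hxT⟩ := Set.mem_iUnion₂.1
      (closure_minimal interior_subset (Mesh.isClosed_biUnion h𝒮) hxc)
    exact hxω (interior_mono (Set.subset_biUnion_of_mem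
      (u := fun S : Finset (Pt d) => convexHull ℝ (S : Set (Pt d))) hT)
      (mem_interior_of_notMem_frontier hxT (hx T (h𝒮 hT))))
  have h : (w : Pt d → ℝ) =ᶠ[nhds x] fun _ => 0 := by
    filter_upwards [isClosed_closure.isOpen_compl.mem_nhds hxc] with y hy using hw y hy
  rw [gradient_congr h, gradient]
  simp

end Gradients

/-! ### The energy form -/

section Energy

variable {d : ℕ} {Ω : Set (Pt d)} {𝒯 : Mesh Ω} {r : ℕ} {α β : ℝ}
  {A : Pt d → Matrix (Fin d) (Fin d) ℝ}

/-- The bilinear form `(ζ, η) ↦ (M ζ) · η` of a matrix. -/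
def matrixForm (M : Matrix (Fin d) (Fin d) ℝ) : LinearMap.BilinForm ℝ (Pt d) :=
  LinearMap.mk₂ ℝ (fun ζ η => (M *ᵥ ζ.ofLp) ⬝ᵥ η.ofLp)
    (fun a b c => by simp [Matrix.mulVec_add, add_dotProduct])
    (fun c a b => by simp [Matrix.mulVec_smul, smul_dotProduct])
    (fun a b c => by simp [dotProduct_add])
    (fun c a b => by simp [dotProduct_smul])

theorem matrixForm_apply (M : Matrix (Fin d) (Fin d) ℝ) (ζ η : Pt d) :
    matrixForm M ζ η = (M *ᵥ ζ.ofLp) ⬝ᵥ η.ofLp := rfl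

theorem energy_eq (ω : Set (Pt d)) (u v : Pt d → ℝ) :
    energy A ω u v = ∫ x in ω, matrixForm (A x) (gradient u x) (gradient v x) := rfl

theorem matrixForm_symm {M : Matrix (Fin d) (Fin d) ℝ} (hM : M.IsSymm) (ζ η : Pt d) :
    matrixForm M ζ η = matrixForm M η ζ := by
  rw [matrixForm_apply, matrixForm_apply, dotProduct_comm, Matrix.dotProduct_mulVec,
    ← Matrix.mulVec_transpose, hM.eq]

theorem IsEllipticCoefficient.form_nonneg (hA : IsEllipticCoefficient Ω α β A) :
    ∀ᵐ x ∂(volume.restrict Ω), ∀ ζ : Pt d, 0 ≤ matrixForm (A x) ζ ζ := by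
  filter_upwards [hA.lower] with x hx ζ
  refine le_trans (mul_nonneg hA.alpha_pos.le ?_) (hx ζ.ofLp)
  exact Finset.sum_nonneg fun i _ => mul_self_nonneg _

theorem IsEllipticCoefficient.abs_form_le (hA : IsEllipticCoefficient Ω α β A) :
    ∀ᵐ x ∂(volume.restrict Ω), ∀ ζ η : Pt d, |matrixForm (A x) ζ η| ≤ β * (‖ζ‖ ^ 2 + ‖η‖ ^ 2) := by
  filter_upwards [hA.form_nonneg, hA.upper, hA.isSymm] with x h0 h1 h2 ζ η
  have hβ : ∀ ζ : Pt d, matrixForm (A x) ζ ζ ≤ β * ‖ζ‖ ^ 2 := by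
    intro ζ
    refine (h1 ζ.ofLp).trans_eq ?_
    rw [EuclideanSpace.real_norm_sq_eq]
    simp [dotProduct, sq]
  have h3 := abs_add_le_of_nonneg h0 ζ η
  rw [matrixForm_symm h2 η ζ, ← two_mul, abs_mul, abs_two] at h3
  nlinarith [hβ ζ, hβ η, h0 ζ, h0 η]

theorem aestronglyMeasurable_form (hA : IsEllipticCoefficient Ω α β A) (u v : Pt d → ℝ) :
    AEStronglyMeasurable (fun x => matrixForm (A x) (gradient u x) (gradient v x))
      (volume.restrict Ω) := by
  have hg : ∀ (f : Pt d → ℝ) (k : Fin d), Measurable fun x => (gradient f x).ofLp k := fun f k =>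
    (EuclideanSpace.proj (𝕜 := ℝ) k).continuous.measurable.comp (measurable_gradient f)
  simp only [matrixForm_apply, dotProduct, Matrix.mulVec]
  refine AEMeasurable.aestronglyMeasurable ?_
  refine Finset.aemeasurable_fun_sum _ fun k _ => ?_
  refine AEMeasurable.mul (Finset.aemeasurable_fun_sum _ fun l _ => ?_) (hg v k).aemeasurable
  exact (hA.measurable_entries k l).mul (hg u l).aemeasurable

theorem integrableOn_form (hA : IsEllipticCoefficient Ω α β A) (hΩb : Bornology.IsBounded Ω)
    (hΩo : IsOpen Ω) (u v : femSpace 𝒯 r) :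
    IntegrableOn (fun x => matrixForm (A x) (gradient (u : Pt d → ℝ) x)
      (gradient (v : Pt d → ℝ) x)) Ω := by
  obtain ⟨C, hC⟩ := exists_gradient_bound u
  obtain ⟨C', hC'⟩ := exists_gradient_bound v
  have hβ : 0 ≤ β := (hA.alpha_pos.trans hA.alpha_lt_beta).le
  have : IsFiniteMeasure (volume.restrict Ω) :=
    isFiniteMeasure_restrict.2 hΩb.measure_lt_top.ne
  refine Integrable.of_bound (aestronglyMeasurable_form hA _ _) (β * (C ^ 2 + C' ^ 2)) ?_
  filter_upwards [hA.abs_form_le, ae_restrict_of_ae hC, ae_restrict_of_ae hC',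
    ae_restrict_mem hΩo.measurableSet] with x h1 h2 h3 hx
  rw [Real.norm_eq_abs]
  refine (h1 _ _).trans (mul_le_mul_of_nonneg_left ?_ hβ)
  exact add_le_add (pow_le_pow_left₀ (norm_nonneg _) (h2 hx) 2)
    (pow_le_pow_left₀ (norm_nonneg _) (h3 hx) 2)

/-- The energy form as a bilinear form on the finite element space. -/
def energyForm (hA : IsEllipticCoefficient Ω α β A) (hΩb : Bornology.IsBounded Ω)
    (hΩo : IsOpen Ω) (𝒯 : Mesh Ω) (r : ℕ) {ω : Set (Pt d)} (hω : IsOpen ω) (hωΩ : ω ⊆ Ω) :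
    LinearMap.BilinForm ℝ (femSpace 𝒯 r) :=
  LinearMap.mk₂ ℝ (fun u v => energy A ω (u : Pt d → ℝ) (v : Pt d → ℝ))
    (fun u v w => by
      rw [energy_eq, energy_eq, energy_eq, ← integral_add
        ((integrableOn_form hA hΩb hΩo u w).mono_set hωΩ)
        ((integrableOn_form hA hΩb hΩo v w).mono_set hωΩ)]
      refine integral_congr_ae ?_
      filter_upwards [ae_restrict_of_ae (ae_gradient_add u v),
        ae_restrict_mem hω.measurableSet] with x h hx
      rw [h (hωΩ hx), map_add, LinearMap.add_apply])
    (fun c u w => by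
      rw [energy_eq, energy_eq, smul_eq_mul, ← integral_const_mul]
      refine integral_congr_ae ?_
      filter_upwards [ae_restrict_of_ae (ae_gradient_smul c u),
        ae_restrict_mem hω.measurableSet] with x h hx
      rw [h (hωΩ hx), map_smul, LinearMap.smul_apply, smul_eq_mul])
    (fun w u v => by
      rw [energy_eq, energy_eq, energy_eq, ← integral_add
        ((integrableOn_form hA hΩb hΩo w u).mono_set hωΩ)
        ((integrableOn_form hA hΩb hΩo w v).mono_set hωΩ)]
      refine integral_congr_ae ?_
      filter_upwards [ae_restrict_of_ae (ae_gradient_add u v),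
        ae_restrict_mem hω.measurableSet] with x h hx
      rw [h (hωΩ hx), map_add])
    (fun c w u => by
      rw [energy_eq, energy_eq, smul_eq_mul, ← integral_const_mul]
      refine integral_congr_ae ?_
      filter_upwards [ae_restrict_of_ae (ae_gradient_smul c u),
        ae_restrict_mem hω.measurableSet] with x h hx
      rw [h (hωΩ hx), map_smul, smul_eq_mul])

theorem energy_comm (hA : IsEllipticCoefficient Ω α β A) {ω : Set (Pt d)} (hωΩ : ω ⊆ Ω)
    (u v : Pt d → ℝ) : energy A ω u v = energy A ω v u := by
  refine integral_congr_ae ?_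
  filter_upwards [ae_restrict_of_ae_restrict_of_subset hωΩ hA.isSymm] with x hx
  exact matrixForm_symm hx _ _

theorem energy_nonneg (hA : IsEllipticCoefficient Ω α β A) {ω : Set (Pt d)} (hωΩ : ω ⊆ Ω)
    (u : Pt d → ℝ) : 0 ≤ energy A ω u u := by
  refine integral_nonneg_of_ae ?_
  filter_upwards [ae_restrict_of_ae_restrict_of_subset hωΩ hA.form_nonneg] with x hx
  exact hx _

theorem energy_congr {ω : Set (Pt d)} (hω : IsOpen ω) {u u' v v' : Pt d → ℝ}
    (hu : Set.EqOn u u' ω) (hv : Set.EqOn v v' ω) : energy A ω u v = energy A ω u' v' := by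
  refine setIntegral_congr_fun hω.measurableSet fun x hx => ?_
  have h1 : u =ᶠ[nhds x] u' := by filter_upwards [hω.mem_nhds hx] with y hy using hu hy
  have h2 : v =ᶠ[nhds x] v' := by filter_upwards [hω.mem_nhds hx] with y hy using hv hy
  simp only [gradient_congr h1, gradient_congr h2]

theorem energy_eq_of_mem_localSpaceZero {ω : Set (Pt d)} (hω : 𝒯.Resolves ω)
    (hΩo : IsOpen Ω) (hωΩ : ω ⊆ Ω) (u : Pt d → ℝ) {w : femSpace 𝒯 r}
    (hw : w ∈ localSpaceZero 𝒯 r ω) : energy A Ω u w = energy A ω u w := by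
  refine setIntegral_eq_of_subset_of_ae_sdiff_eq_zero hΩo.measurableSet.nullMeasurableSet hωΩ ?_
  filter_upwards [ae_gradient_eq_zero hω hw] with x hx hxd
  rw [hx hxd.2]
  simp

end Energy

/-! ### Finite overlap -/

section Overlap

variable {d : ℕ} {Ω : Set (Pt d)} {𝒯 : Mesh Ω} {r M : ℕ} {α β : ℝ}
  {A : Pt d → Matrix (Fin d) (Fin d) ℝ}

theorem ncard_le_overlapNumber (ω : Fin M → Set (Pt d)) {x : Pt d} (hx : x ∈ Ω) :
    {i | x ∈ ω i}.ncard ≤ overlapNumber Ω ω := by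
  refine le_csSup ⟨M, ?_⟩ (Set.mem_image_of_mem _ hx)
  rintro _ ⟨y, -, rfl⟩
  exact (Set.ncard_le_ncard (Set.subset_univ _)).trans (by simp)

open Classical in
theorem card_le_overlapNumber (ω : Fin M → Set (Pt d)) {x : Pt d} (hx : x ∈ Ω) :
    (Finset.univ.filter fun i => x ∈ ω i).card ≤ overlapNumber Ω ω := by
  refine le_of_eq_of_le ?_ (ncard_le_overlapNumber ω hx)
  rw [← Set.ncard_coe_finset]
  simp

/-- At almost every point at most `overlapNumber Ω ω` of the gradients are nonzero, so the
Cauchy–Schwarz factor in `form_sum_le` is that number and not `M`. -/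
theorem energy_sum_le (hA : IsEllipticCoefficient Ω α β A) (hΩb : Bornology.IsBounded Ω)
    (hΩo : IsOpen Ω) (ω : Fin M → Set (Pt d)) (hω : ∀ i, 𝒯.Resolves (ω i)) (hωΩ : ∀ i, ω i ⊆ Ω)
    (f : Fin M → femSpace 𝒯 r) (hf : ∀ i, f i ∈ localSpaceZero 𝒯 r (ω i)) :
    energy A Ω (∑ i, f i : femSpace 𝒯 r) (∑ i, f i : femSpace 𝒯 r) ≤
      overlapNumber Ω ω * ∑ i, energy A (ω i) (f i) (f i) := by
  classical
  rw [Finset.sum_congr rfl fun i _ =>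
    (energy_eq_of_mem_localSpaceZero (hω i) hΩo (hωΩ i) (f i) (hf i)).symm]
  simp only [energy_eq]
  rw [← integral_finsetSum _ fun i _ => integrableOn_form hA hΩb hΩo (f i) (f i),
    ← integral_const_mul]
  refine integral_mono_ae (integrableOn_form hA hΩb hΩo _ _) (Integrable.const_mul
    (integrable_finsetSum _ fun i _ => integrableOn_form hA hΩb hΩo (f i) (f i)) _) ?_
  have h0 : ∀ᵐ x : Pt d, ∀ i, x ∉ ω i → gradient (f i : Pt d → ℝ) x = 0 :=
    ae_all_iff.2 fun i => ae_gradient_eq_zero (hω i) (hf i)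
  filter_upwards [hA.form_nonneg, ae_restrict_of_ae (ae_gradient_sum Finset.univ f),
    ae_restrict_of_ae h0, ae_restrict_mem hΩo.measurableSet] with x h1 h2 h3 hx
  have h4 : ∑ i, gradient (f i : Pt d → ℝ) x =
      ∑ i ∈ Finset.univ.filter fun i => x ∈ ω i, gradient (f i : Pt d → ℝ) x :=
    (Finset.sum_filter_of_ne fun i _ hne => by
      by_contra hi
      exact hne (h3 i hi)).symm
  have h5 : ∑ i ∈ Finset.univ.filter (fun i => x ∈ ω i),
      matrixForm (A x) (gradient (f i : Pt d → ℝ) x) (gradient (f i : Pt d → ℝ) x) ≤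
      ∑ i, matrixForm (A x) (gradient (f i : Pt d → ℝ) x) (gradient (f i : Pt d → ℝ) x) :=
    Finset.sum_le_sum_of_subset_of_nonneg (Finset.filter_subset _ _) fun i _ _ => h1 _
  simp only [h2 hx, h4]
  refine (form_sum_le h1 _ _).trans (mul_le_mul (by exact_mod_cast card_le_overlapNumber ω hx) h5
    (Finset.sum_nonneg fun i _ => h1 _) (Nat.cast_nonneg _))

theorem sum_energy_le (hA : IsEllipticCoefficient Ω α β A) (hΩb : Bornology.IsBounded Ω)
    (hΩo : IsOpen Ω) (ω : Fin M → Set (Pt d)) (hω : ∀ i, IsOpen (ω i)) (hωΩ : ∀ i, ω i ⊆ Ω)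
    (v : femSpace 𝒯 r) :
    ∑ i, energy A (ω i) v v ≤ overlapNumber Ω ω * energy A Ω v v := by
  classical
  have hv := integrableOn_form hA hΩb hΩo v v
  have h : ∀ i, energy A (ω i) v v = ∫ x in Ω, (ω i).indicator (fun x => matrixForm (A x)
      (gradient (v : Pt d → ℝ) x) (gradient (v : Pt d → ℝ) x)) x := fun i => by
    rw [setIntegral_indicator (hω i).measurableSet, Set.inter_eq_right.2 (hωΩ i), energy_eq]
  rw [Finset.sum_congr rfl fun i _ => h i, ← integral_finsetSum _ fun i _ =>
    hv.indicator (hω i).measurableSet, energy_eq, ← integral_const_mul]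
  refine integral_mono_ae (integrable_finsetSum _ fun i _ =>
    hv.indicator (hω i).measurableSet) (Integrable.const_mul hv _) ?_
  filter_upwards [hA.form_nonneg, ae_restrict_mem hΩo.measurableSet] with x h1 hx
  simp only [Set.indicator_apply]
  rw [← Finset.sum_filter, Finset.sum_const, nsmul_eq_mul]
  exact mul_le_mul_of_nonneg_right (by exact_mod_cast card_le_overlapNumber ω hx) (h1 _)

end Overlap

/-! ### Truncation of eigenfunction expansions -/

section Spectral

variable {V : Type*} [AddCommGroup V] [Module ℝ V] {a c : LinearMap.BilinForm ℝ V} {N : ℕ}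
  {φ : Fin N → V} {lam : Fin N → ℝ≥0∞}

/-- The usual argument: symmetry gives `λ_j a = λ_k a` for the pair. An infinite eigenvalue gives
orthogonality at once. -/
theorem form_eq_zero_of_eigenvalue_ne (ha : ∀ v w, a v w = a w v) (hc : ∀ v w, c v w = c w v)
    (h : ∀ j k, if lam j = ∞ then a (φ j) (φ k) = 0
      else c (φ j) (φ k) = (lam j).toReal * a (φ j) (φ k))
    {j k : Fin N} (hjk : lam j ≠ lam k) : a (φ j) (φ k) = 0 := by
  have h1 := h j k
  have h2 := h k j
  by_cases hj : lam j = ∞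
  · rwa [if_pos hj] at h1
  by_cases hk : lam k = ∞
  · rwa [if_pos hk, ha] at h2
  rw [if_neg hj] at h1
  rw [if_neg hk, hc, ha, h1, ← sub_eq_zero, ← sub_mul, mul_eq_zero, sub_eq_zero] at h2
  exact h2.resolve_left fun h3 => hjk ((ENNReal.toReal_eq_toReal_iff' hj hk).1 h3)

/-- The part of an eigenfunction expansion with eigenvalues at most `μ` has `c`-energy at most `μ`
times the `a`-energy of the whole expansion. -/
theorem form_tail_le (ha : ∀ v w, a v w = a w v) (hc : ∀ v w, c v w = c w v)
    (ha0 : ∀ v, 0 ≤ a v v)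
    (h : ∀ j k, if lam j = ∞ then a (φ j) (φ k) = 0
      else c (φ j) (φ k) = (lam j).toReal * a (φ j) (φ k))
    {μ : ℝ≥0∞} (hμ : μ ≠ ∞) (t : Fin N → ℝ) :
    c (∑ j with lam j ≤ μ, t j • φ j) (∑ j with lam j ≤ μ, t j • φ j) ≤
      μ.toReal * a (∑ j, t j • φ j) (∑ j, t j • φ j) := by
  have expand : ∀ (B : LinearMap.BilinForm ℝ V) (s s' : Finset (Fin N)) (p p' : Fin N → ℝ),
      B (∑ j ∈ s, p j • φ j) (∑ k ∈ s', p' k • φ k) =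
        ∑ j ∈ s, ∑ k ∈ s', p j * p' k * B (φ j) (φ k) := by
    intro B s s' p p'
    simp only [map_sum, LinearMap.sum_apply, map_smul, LinearMap.smul_apply, smul_eq_mul]
    simp only [Finset.mul_sum]
    rw [Finset.sum_comm]
    exact Finset.sum_congr rfl fun j _ => Finset.sum_congr rfl fun k _ => by ring
  set s : Finset (Fin N) := {j | lam j ≤ μ} with hs
  set s' : Finset (Fin N) := {j | ¬ lam j ≤ μ} with hs'
  have hsplit : ∑ j, t j • φ j = ∑ j ∈ s, t j • φ j + ∑ j ∈ s', t j • φ j :=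
    (Finset.sum_filter_add_sum_filter_not _ _ _).symm
  have horth : a (∑ j ∈ s, t j • φ j) (∑ j ∈ s', t j • φ j) = 0 := by
    rw [expand]
    refine Finset.sum_eq_zero fun j hj => Finset.sum_eq_zero fun k hk => ?_
    rw [form_eq_zero_of_eigenvalue_ne ha hc h, mul_zero]
    intro hjk
    exact (Finset.mem_filter.1 hk).2 (hjk ▸ (Finset.mem_filter.1 hj).2)
  have hpyth : a (∑ j ∈ s, t j • φ j) (∑ j ∈ s, t j • φ j) ≤
      a (∑ j, t j • φ j) (∑ j, t j • φ j) := by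
    rw [hsplit, form_add_self horth ((ha _ _).trans horth)]
    linarith [ha0 (∑ j ∈ s', t j • φ j)]
  -- Eigenfunctions sharing an eigenvalue need not be orthogonal and `a` may be degenerate, so no
  -- diagonal expansion is available. Instead the defect is the `a`-energy of a reweighted
  -- combination: cross terms between different eigenvalues vanish, and for equal ones the two
  -- square roots multiply to `μ - λ_j`.
  have hdefect : μ.toReal * a (∑ j ∈ s, t j • φ j) (∑ j ∈ s, t j • φ j) -
      c (∑ j ∈ s, t j • φ j) (∑ j ∈ s, t j • φ j) =
      a (∑ j ∈ s, (t j * √(μ.toReal - (lam j).toReal)) • φ j)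
        (∑ j ∈ s, (t j * √(μ.toReal - (lam j).toReal)) • φ j) := by
    rw [expand, expand, expand, Finset.mul_sum, ← Finset.sum_sub_distrib]
    refine Finset.sum_congr rfl fun j hj => ?_
    rw [Finset.mul_sum, ← Finset.sum_sub_distrib]
    refine Finset.sum_congr rfl fun k _ => ?_
    have hj' : lam j ≤ μ := (Finset.mem_filter.1 hj).2
    have h1 := h j k
    rw [if_neg (ne_top_of_le_ne_top hμ hj')] at h1
    by_cases hjk : lam j = lam k
    · have h2 := Real.mul_self_sqrt (sub_nonneg.2 (ENNReal.toReal_mono hμ hj'))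
      rw [← hjk, h1]
      linear_combination (-(t j * t k * a (φ j) (φ k))) * h2
    · rw [h1, form_eq_zero_of_eigenvalue_ne ha hc h hjk]
      ring
  have h3 := mul_le_mul_of_nonneg_left hpyth (ENNReal.toReal_nonneg (a := μ))
  linarith [ha0 (∑ j ∈ s, (t j * √(μ.toReal - (lam j).toReal)) • φ j)]

end Spectral

/-! ### Local approximation by eigenfunctions -/

section Local

variable {d : ℕ} {Ω : Set (Pt d)} {𝒯 : Mesh Ω} {r M : ℕ} {α β : ℝ}
  {A : Pt d → Matrix (Fin d) (Fin d) ℝ} {D : Decomposition 𝒯 M} {χ : Fin M → Pt d → ℝ}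

theorem restrictLocal_restrictGlobal {ω ω' : Set (Pt d)} (h : ω ⊆ ω') (v : femSpace 𝒯 r) :
    restrictLocal 𝒯 r h (restrictGlobal 𝒯 r ω' v) = restrictGlobal 𝒯 r ω v := by
  refine Subtype.ext ?_
  change ω.indicator (ω'.indicator (v : Pt d → ℝ)) = ω.indicator v
  rw [Set.indicator_indicator, Set.inter_eq_left.2 h]

theorem restrictGlobal_surjective (ω : Set (Pt d)) :
    Function.Surjective (restrictGlobal 𝒯 r ω) := by
  rintro ⟨_, v, hv, rfl⟩
  exact ⟨⟨v, hv⟩, rfl⟩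

theorem eqOn_restrictGlobal (ω : Set (Pt d)) (v : femSpace 𝒯 r) :
    Set.EqOn (restrictGlobal 𝒯 r ω v : Pt d → ℝ) v ω :=
  fun _ hx => Set.indicator_of_mem hx _

theorem energy_restrictGlobal {ω : Set (Pt d)} (hω : IsOpen ω) (u v : femSpace 𝒯 r) :
    energy A ω (restrictGlobal 𝒯 r ω u) (restrictGlobal 𝒯 r ω v) = energy A ω u v :=
  energy_congr hω (eqOn_restrictGlobal ω u) (eqOn_restrictGlobal ω v)

theorem localize_eq (i : Fin M) (v : femSpace 𝒯 r) :
    localize r D χ i v = pouOp 𝒯 r (D.dom i) (χ i)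
      (restrictLocal 𝒯 r (D.dom_subset_over i) (restrictGlobal 𝒯 r (D.ovs i) v)) := by
  rw [restrictLocal_restrictGlobal]
  rfl

/-- An eigenfunction expansion reproduces a function on `ω_i^*` only; nothing more is needed for its
localization. -/
theorem localize_congr (i : Fin M) {u v : femSpace 𝒯 r}
    (h : restrictGlobal 𝒯 r (D.ovs i) u = restrictGlobal 𝒯 r (D.ovs i) v) :
    localize r D χ i u = localize r D χ i v := by
  rw [localize_eq, localize_eq, h]

/-- Splitting by the size of the eigenvalue, not by index, keeps eigenspaces whole. The retained
part still uses only the first `m` functions; ties with `λ_{m+1}` go to the discarded part. -/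
theorem lt_of_nextEigenvalue_lt {N m : ℕ} {lam : Fin N → ℝ≥0∞} (hlam : Antitone lam)
    {j : Fin N} (hj : ¬ lam j ≤ nextEigenvalue lam m) : (j : ℕ) < m := by
  by_contra! hmj
  have hm : m < N := hmj.trans_lt j.2
  rw [nextEigenvalue, dif_pos hm] at hj
  exact hj (hlam (Fin.mk_le_of_le_val hmj))

/-- A locally harmonic function is approximated by the leading eigenfunctions. -/
theorem exists_local_approx (hA : IsEllipticCoefficient Ω α β A)
    (hΩb : Bornology.IsBounded Ω) (hΩ : interior (closure Ω) = Ω) (i : Fin M) {N : ℕ}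
    {lam : Fin N → ℝ≥0∞} {φ : Fin N → localSpace 𝒯 r (D.ovs i)}
    (hφ : IsEigensystem A r D χ i lam φ) (m : ℕ) (hm : nextEigenvalue lam m ≠ ∞)
    (v : femSpace 𝒯 r) (hv : ∀ w ∈ localSpaceZero 𝒯 r (D.ovs i), energy A (D.ovs i) v w = 0) :
    ∃ s ∈ (localApproxSpace r D i φ m).map
        ((localSpaceZero 𝒯 r (D.dom i)).subtype ∘ₗ pouOp 𝒯 r (D.dom i) (χ i)),
      energy A (D.dom i) (localize r D χ i v - s : femSpace 𝒯 r)
        (localize r D χ i v - s : femSpace 𝒯 r) ≤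
      (nextEigenvalue lam m).toReal * energy A (D.ovs i) v v := by
  have hΩo : IsOpen Ω := hΩ ▸ isOpen_interior
  have ho := (D.resolves_over i).isOpen
  have hd := (D.resolves_dom i).isOpen
  have hoΩ := (D.resolves_over i).subset hΩ
  have hdΩ := (D.resolves_dom i).subset hΩ
  -- Lifting the eigenfunctions to `V_h` lets both forms of the eigenproblem live on one space.
  choose g hg using fun j => restrictGlobal_surjective (𝒯 := 𝒯) (r := r) (D.ovs i) (φ j)
  have hvh : restrictGlobal 𝒯 r (D.ovs i) v ∈ harmonicSpace A 𝒯 r (D.ovs i) := fun w hw => by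
    rw [energy_congr ho (eqOn_restrictGlobal (D.ovs i) v) fun _ _ => rfl]
    exact hv w hw
  rw [← hφ.span_eq] at hvh
  obtain ⟨t, ht⟩ := (Submodule.mem_span_range_iff_exists_fun ℝ).1 hvh
  have hvt : restrictGlobal 𝒯 r (D.ovs i) v = restrictGlobal 𝒯 r (D.ovs i) (∑ j, t j • g j) := by
    rw [← ht, map_sum]
    exact Finset.sum_congr rfl fun j _ => by rw [map_smul, hg]
  set a := energyForm hA hΩb hΩo 𝒯 r ho hoΩ with ha
  set c := (energyForm hA hΩb hΩo 𝒯 r hd hdΩ).compl₁₂ (localize r D χ i) (localize r D χ i) with hc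
  have hsolve : ∀ j k, if lam j = ∞ then a (g j) (g k) = 0
      else c (g j) (g k) = (lam j).toReal * a (g j) (g k) := by
    intro j k
    have hk : φ k ∈ harmonicSpace A 𝒯 r (D.ovs i) := by
      rw [← hφ.span_eq]
      exact Submodule.subset_span ⟨k, rfl⟩
    have h1 := hφ.solves j (φ k) hk
    rw [← hg j, ← hg k, energy_restrictGlobal ho, ← localize_eq, ← localize_eq] at h1
    exact h1
  have htail := form_tail_le (a := a) (c := c) (fun u w => energy_comm hA hoΩ u w)
    (fun u w => energy_comm hA hdΩ (localize r D χ i u) (localize r D χ i w))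
    (fun u => energy_nonneg hA hoΩ u) hsolve hm t
  refine ⟨∑ j with ¬ lam j ≤ nextEigenvalue lam m, t j • localize r D χ i (g j),
    Submodule.sum_mem _ fun j hj => Submodule.smul_mem _ _ ?_, ?_⟩
  · refine ⟨restrictLocal 𝒯 r (D.dom_subset_over i) (φ j), Submodule.subset_span ⟨j,
      lt_of_nextEigenvalue_lt hφ.antitone (Finset.mem_filter.1 hj).2, rfl⟩, ?_⟩
    rw [localize_eq, hg]
    rfl
  · have e1 : localize r D χ i v -
        ∑ j with ¬ lam j ≤ nextEigenvalue lam m, t j • localize r D χ i (g j) =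
        localize r D χ i (∑ j with lam j ≤ nextEigenvalue lam m, t j • g j) := by
      rw [localize_congr i hvt, sub_eq_iff_eq_add, map_sum, map_sum,
        ← Finset.sum_filter_add_sum_filter_not _ fun j => lam j ≤ nextEigenvalue lam m]
      simp only [map_smul]
    have e2 : energy A (D.ovs i) v v = a (∑ j, t j • g j) (∑ j, t j • g j) := by
      rw [← energy_restrictGlobal ho, hvt, energy_restrictGlobal ho]
      rfl
    rw [e1, e2]
    exact htail

theorem localSpaceZero_of_mem_coarse (i : Fin M) {N : ℕ} {φ : Fin N → localSpace 𝒯 r (D.ovs i)}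
    {m : ℕ} {s : femSpace 𝒯 r} (hs : s ∈ (localApproxSpace r D i φ m).map
        ((localSpaceZero 𝒯 r (D.dom i)).subtype ∘ₗ pouOp 𝒯 r (D.dom i) (χ i))) :
    s ∈ localSpaceZero 𝒯 r (D.dom i) := by
  obtain ⟨w, -, rfl⟩ := hs
  exact (pouOp 𝒯 r (D.dom i) (χ i) w).2

/-- The contraction estimate of the two-level method, at the level of functions. -/
theorem energy_two_level_le (hA : IsEllipticCoefficient Ω α β A)
    (hΩb : Bornology.IsBounded Ω) (hΩ : interior (closure Ω) = Ω)
    {N : Fin M → ℕ} {lam : ∀ i, Fin (N i) → ℝ≥0∞}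
    {φ : ∀ i, Fin (N i) → localSpace 𝒯 r (D.ovs i)}
    (hφ : ∀ i, IsEigensystem A r D χ i (lam i) (φ i)) (m : Fin M → ℕ)
    (hm : (Finset.univ.sup fun i => nextEigenvalue (lam i) (m i)) ≠ ∞)
    (v : femSpace 𝒯 r) (p : Fin M → femSpace 𝒯 r)
    (hp : ∀ i, p i ∈ localSpaceZero 𝒯 r (D.ovs i))
    (hvp : ∀ i, ∀ w ∈ localSpaceZero 𝒯 r (D.ovs i), energy A Ω (v - p i : femSpace 𝒯 r) w = 0)
    {s₀ : femSpace 𝒯 r} (hs₀ : s₀ ∈ coarseSpace r D χ φ m)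
    (horth : ∀ s ∈ coarseSpace r D χ φ m,
      energy A Ω (∑ i, localize r D χ i (v - p i) - s₀ : femSpace 𝒯 r) s = 0) :
    energy A Ω (∑ i, localize r D χ i (v - p i) - s₀ : femSpace 𝒯 r)
        (∑ i, localize r D χ i (v - p i) - s₀ : femSpace 𝒯 r) ≤
      overlapNumber Ω D.dom * overlapNumber Ω D.ovs *
        (Finset.univ.sup fun i => nextEigenvalue (lam i) (m i)).toReal * energy A Ω v v := by
  have hΩo : IsOpen Ω := hΩ ▸ isOpen_interior
  have hoΩ := fun i => (D.resolves_over i).subset hΩ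
  have hdΩ := fun i => (D.resolves_dom i).subset hΩ
  have ho := fun i => (D.resolves_over i).isOpen
  set μ := Finset.univ.sup fun i => nextEigenvalue (lam i) (m i) with hμ
  have hμi : ∀ i, nextEigenvalue (lam i) (m i) ≤ μ := fun i =>
    Finset.le_sup (f := fun i => nextEigenvalue (lam i) (m i)) (Finset.mem_univ i)
  have hharm : ∀ i, ∀ w ∈ localSpaceZero 𝒯 r (D.ovs i),
      energy A (D.ovs i) (v - p i : femSpace 𝒯 r) w = 0 := fun i w hw => by
    rw [← energy_eq_of_mem_localSpaceZero (D.resolves_over i) hΩo (hoΩ i) _ hw]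
    exact hvp i w hw
  choose s hs hsle using fun i => exists_local_approx hA hΩb hΩ i (hφ i) (m i)
    (ne_top_of_le_ne_top hm (hμi i)) (v - p i) (hharm i)
  -- Pythagoras on `ω_i^*`: `v - p i` is orthogonal to `p i`.
  have hloc : ∀ i, energy A (D.ovs i) (v - p i : femSpace 𝒯 r) (v - p i : femSpace 𝒯 r) ≤
      energy A (D.ovs i) v v := by
    intro i
    set a := energyForm hA hΩb hΩo 𝒯 r (ho i) (hoΩ i) with ha
    have h1 : a (v - p i) (p i) = 0 := hharm i (p i) (hp i)
    have h2 : a (p i) (v - p i) = 0 := (energy_comm hA (hoΩ i) _ _).trans h1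
    have h3 : a v v = a (v - p i) (v - p i) + a (p i) (p i) := by
      rw [← form_add_self h1 h2, sub_add_cancel]
    have h4 : 0 ≤ a (p i) (p i) := energy_nonneg hA (hoΩ i) _
    change a (v - p i) (v - p i) ≤ a v v
    linarith
  have hS : ∑ i, s i ∈ coarseSpace r D χ φ m := Submodule.sum_mem _ fun i _ =>
    Submodule.mem_iSup_of_mem i (hs i)
  -- The projection `s₀` is the best coarse approximation, so it may be replaced by the sum of the
  -- local ones.
  have hmin : energy A Ω (∑ i, localize r D χ i (v - p i) - s₀ : femSpace 𝒯 r)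
        (∑ i, localize r D χ i (v - p i) - s₀ : femSpace 𝒯 r) ≤
      energy A Ω (∑ i, (localize r D χ i (v - p i) - s i) : femSpace 𝒯 r)
        (∑ i, (localize r D χ i (v - p i) - s i) : femSpace 𝒯 r) := by
    set a := energyForm hA hΩb hΩo 𝒯 r hΩo subset_rfl with ha
    rw [Finset.sum_sub_distrib]
    set w := ∑ i, localize r D χ i (v - p i)
    set z := s₀ - ∑ i, s i with hz
    have h1 : a (w - s₀) z = 0 := horth z (Submodule.sub_mem _ hs₀ hS)
    have h2 : a z (w - s₀) = 0 := (energy_comm hA subset_rfl _ _).trans h1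
    have h3 : w - ∑ i, s i = (w - s₀) + z := by rw [hz]; abel
    have h4 : 0 ≤ a z z := energy_nonneg hA subset_rfl _
    rw [h3]
    change a (w - s₀) (w - s₀) ≤ a (w - s₀ + z) (w - s₀ + z)
    rw [form_add_self h1 h2]
    linarith
  have hterm : ∀ i, energy A (D.dom i) (localize r D χ i (v - p i) - s i : femSpace 𝒯 r)
      (localize r D χ i (v - p i) - s i : femSpace 𝒯 r) ≤ μ.toReal * energy A (D.ovs i) v v :=
    fun i => (hsle i).trans (mul_le_mul (ENNReal.toReal_mono hm (hμi i)) (hloc i)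
      (energy_nonneg hA (hoΩ i) _) ENNReal.toReal_nonneg)
  calc _ ≤ _ := hmin
    _ ≤ overlapNumber Ω D.dom * ∑ i, energy A (D.dom i)
          (localize r D χ i (v - p i) - s i : femSpace 𝒯 r)
          (localize r D χ i (v - p i) - s i : femSpace 𝒯 r) :=
        energy_sum_le hA hΩb hΩo D.dom D.resolves_dom hdΩ _ fun i =>
          Submodule.sub_mem _ (localize_mem i _) (localSpaceZero_of_mem_coarse i (hs i))
    _ ≤ overlapNumber Ω D.dom * (μ.toReal * (overlapNumber Ω D.ovs * energy A Ω v v)) := by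
        refine mul_le_mul_of_nonneg_left ?_ (Nat.cast_nonneg _)
        refine (Finset.sum_le_sum fun i _ => hterm i).trans ?_
        rw [← Finset.mul_sum]
        exact mul_le_mul_of_nonneg_left (sum_energy_le hA hΩb hΩo D.ovs ho hoΩ v)
          ENNReal.toReal_nonneg
    _ = _ := by ring

end Local

/-! ### GMRES -/

section GMRES

variable {n : ℕ}

theorem krylov_mono (C : Matrix (Fin n) (Fin n) ℝ) (e : Fin n → ℝ) {j k : ℕ} (h : j ≤ k) :
    krylov C e j ≤ krylov C e k :=
  Submodule.span_mono fun _ ⟨l, h1, h2, h3⟩ => ⟨l, h1, h2.trans h, h3⟩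

theorem mulVec_mem_krylov {C : Matrix (Fin n) (Fin n) ℝ} {e w : Fin n → ℝ} {j : ℕ}
    (hw : w ∈ krylov C e j) : C *ᵥ w ∈ krylov C e (j + 1) := by
  suffices h : krylov C e j ≤ (krylov C e (j + 1)).comap C.mulVecLin from h hw
  refine Submodule.span_le.2 ?_
  rintro _ ⟨k, h1, h2, rfl⟩
  exact Submodule.subset_span ⟨k + 1, by lia, by lia, by
    rw [pow_succ', ← Matrix.mulVec_mulVec, Matrix.mulVecLin_apply]⟩

/-- `1 - (1 - t) ^ j` has no constant term and degree at most `j`. -/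
theorem sub_pow_mulVec_mem_krylov (C : Matrix (Fin n) (Fin n) ℝ) (e : Fin n → ℝ) (j : ℕ) :
    e - (1 - C) ^ j *ᵥ e ∈ krylov C e j := by
  induction j with
  | zero => simp
  | succ j ih =>
    have h1 : e - (1 - C) ^ (j + 1) *ᵥ e =
        (e - (1 - C) ^ j *ᵥ e) + (C *ᵥ e - C *ᵥ (e - (1 - C) ^ j *ᵥ e)) := by
      rw [pow_succ', sub_mul, one_mul, Matrix.sub_mulVec, ← Matrix.mulVec_mulVec,
        Matrix.mulVec_sub]
      abel
    rw [h1]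
    refine Submodule.add_mem _ (krylov_mono C e j.le_succ ih) (Submodule.sub_mem _ ?_
      (mulVec_mem_krylov ih))
    exact Submodule.subset_span ⟨1, le_rfl, by lia, by rw [pow_one]⟩

theorem bNorm_zero (b : LinearMap.BilinForm ℝ (Fin n → ℝ)) : bNorm b 0 = 0 := by
  simp [bNorm]

/-- Convergence of GMRES for a preconditioned operator `C` such that `1 - C` is a contraction in
the energy norm. -/
theorem gmres_bound {b : LinearMap.BilinForm ℝ (Fin n → ℝ)} {AA C : Matrix (Fin n) (Fin n) ℝ}
    {u : Fin n → ℝ} {x : ℕ → Fin n → ℝ} (hx : IsGMRESSequence b C u x) {b₁ b₂ : ℝ}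
    (hb₁ : 0 < b₁)
    (hnorm : ∀ v : Fin n → ℝ, b₁ * bNorm b v ≤ aNorm AA v ∧ aNorm AA v ≤ b₂ * bNorm b v)
    {L : ℝ} (hL : 0 ≤ L) (hC : ∀ v, aNorm AA ((1 - C) *ᵥ v) ≤ L * aNorm AA v) {j : ℕ}
    (hj : 1 ≤ j) :
    bNorm b (C *ᵥ (u - x j)) ≤ L ^ j * (b₂ / b₁) * bNorm b (C *ᵥ (u - x 0)) := by
  have hpow : ∀ (k : ℕ) (v : Fin n → ℝ), aNorm AA ((1 - C) ^ k *ᵥ v) ≤ L ^ k * aNorm AA v := by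
    intro k v
    induction k with
    | zero => simp
    | succ k ih =>
      rw [pow_succ', ← Matrix.mulVec_mulVec]
      refine (hC _).trans ((mul_le_mul_of_nonneg_left ih hL).trans_eq ?_)
      ring
  set e := u - x 0 with he
  have h1 := (hx j hj).2 (u - (1 - C) ^ j *ᵥ e) (by
    have := sub_pow_mulVec_mem_krylov C e j
    rwa [sub_right_comm])
  -- The residual is propagated by the same polynomial as the error, so the energy contraction
  -- applies to it directly.
  have hcomm : C *ᵥ ((1 - C) ^ j *ᵥ e) = (1 - C) ^ j *ᵥ (C *ᵥ e) := by
    rw [Matrix.mulVec_mulVec, Matrix.mulVec_mulVec,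
      (((Commute.one_right C).sub_right (Commute.refl C)).pow_right j).eq]
  rw [sub_sub_cancel, hcomm] at h1
  refine h1.trans ?_
  have h2 := ((hnorm ((1 - C) ^ j *ᵥ (C *ᵥ e))).1.trans (hpow j _)).trans
    (mul_le_mul_of_nonneg_left (hnorm (C *ᵥ e)).2 (pow_nonneg hL j))
  rw [mul_comm b₁, ← le_div_iff₀ hb₁] at h2
  refine h2.trans_eq ?_
  ring

end GMRES

/-! ### Matrix representation -/

section Matrices

variable {d : ℕ} {Ω : Set (Pt d)} {𝒯 : Mesh Ω} {r n M : ℕ} {α β : ℝ}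
  {A : Pt d → Matrix (Fin d) (Fin d) ℝ} {ψ : Module.Basis (Fin n) ℝ (femSpace 𝒯 r)}

theorem equivFun_symm_toMatrix {s t : ℕ} {W W' : Type*} [AddCommMonoid W] [Module ℝ W]
    [AddCommMonoid W'] [Module ℝ W'] (e : Module.Basis (Fin s) ℝ W)
    (e' : Module.Basis (Fin t) ℝ W') (f : W →ₗ[ℝ] W') (z : Fin s → ℝ) :
    e'.equivFun.symm (LinearMap.toMatrix e e' f *ᵥ z) = f (e.equivFun.symm z) := by
  have h := LinearMap.toMatrix_mulVec_repr e e' f (e.equivFun.symm z)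
  rw [LinearEquiv.symm_apply_eq]
  rw [← Module.Basis.equivFun_apply, LinearEquiv.apply_symm_apply] at h
  rw [h, Module.Basis.equivFun_apply]

theorem equivFun_symm_embeddingMatrix {s : ℕ} {W : Submodule ℝ (femSpace 𝒯 r)}
    (e : Module.Basis (Fin s) ℝ W) (z : Fin s → ℝ) :
    ψ.equivFun.symm (embeddingMatrix ψ e *ᵥ z) = (e.equivFun.symm z : femSpace 𝒯 r) :=
  equivFun_symm_toMatrix e ψ W.subtype z

theorem energy_equivFun_symm (hA : IsEllipticCoefficient Ω α β A)
    (hΩb : Bornology.IsBounded Ω) (hΩo : IsOpen Ω) (x y : Fin n → ℝ) :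
    energy A Ω (ψ.equivFun.symm x : femSpace 𝒯 r) (ψ.equivFun.symm y : femSpace 𝒯 r) =
      x ⬝ᵥ (stiffness A ψ *ᵥ y) := by
  change energyForm hA hΩb hΩo 𝒯 r hΩo subset_rfl (ψ.equivFun.symm x) (ψ.equivFun.symm y) = _
  simp only [Module.Basis.equivFun_symm_apply, map_sum, LinearMap.sum_apply, map_smul,
    LinearMap.smul_apply, smul_eq_mul, dotProduct, Matrix.mulVec, stiffness, Matrix.of_apply,
    Finset.mul_sum]
  rw [Finset.sum_comm]
  refine Finset.sum_congr rfl fun k _ => Finset.sum_congr rfl fun l _ => ?_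
  change y l * (x k * energy A Ω (ψ k) (ψ l)) = _
  ring

theorem aNorm_stiffness (hA : IsEllipticCoefficient Ω α β A)
    (hΩb : Bornology.IsBounded Ω) (hΩo : IsOpen Ω) (x : Fin n → ℝ) :
    aNorm (stiffness A ψ) x =
      √(energy A Ω (ψ.equivFun.symm x : femSpace 𝒯 r) (ψ.equivFun.symm x : femSpace 𝒯 r)) := by
  rw [aNorm, energy_equivFun_symm hA hΩb hΩo]

/-- The Galerkin projection onto a subspace, in matrix form. -/
theorem galerkin_orthogonal (hA : IsEllipticCoefficient Ω α β A)
    (hΩb : Bornology.IsBounded Ω) (hΩo : IsOpen Ω)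
    (hpos : ∀ x : Fin n → ℝ, x ≠ 0 → 0 < x ⬝ᵥ (stiffness A ψ *ᵥ x)) {s : ℕ}
    {W : Submodule ℝ (femSpace 𝒯 r)} (e : Module.Basis (Fin s) ℝ W) (x : Fin n → ℝ)
    {w : femSpace 𝒯 r} (hw : w ∈ W) :
    energy A Ω (ψ.equivFun.symm x - (e.equivFun.symm
      (((embeddingMatrix ψ e)ᵀ * stiffness A ψ * embeddingMatrix ψ e)⁻¹ *ᵥ
        ((embeddingMatrix ψ e)ᵀ *ᵥ (stiffness A ψ *ᵥ x))) : femSpace 𝒯 r) : femSpace 𝒯 r) w = 0 := by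
  set R := embeddingMatrix ψ e with hR
  set G := Rᵀ * stiffness A ψ * R with hG
  have hGv : ∀ y, G *ᵥ y = Rᵀ *ᵥ (stiffness A ψ *ᵥ (R *ᵥ y)) := fun y => by
    simp only [hG, Matrix.mulVec_mulVec, Matrix.mul_assoc]
  have hadj : ∀ (y : Fin s → ℝ) (z : Fin n → ℝ), y ⬝ᵥ (Rᵀ *ᵥ z) = (R *ᵥ y) ⬝ᵥ z := fun y z => by
    rw [Matrix.dotProduct_mulVec, Matrix.vecMul_transpose]
  -- The Galerkin matrix inherits definiteness from the stiffness matrix, since the embedding is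
  -- injective; hence its inverse is a genuine one.
  have hinj : Function.Injective G.mulVec := by
    refine (injective_iff_map_eq_zero G.mulVecLin).2 fun y hy => ?_
    have hRy : R *ᵥ y = 0 := by
      by_contra hne
      have h1 := hpos _ hne
      rw [← hadj, ← hGv] at h1
      rw [Matrix.mulVecLin_apply] at hy
      rw [hy, dotProduct_zero] at h1
      exact h1.false
    have h2 := equivFun_symm_embeddingMatrix (ψ := ψ) e y
    rw [← hR, hRy, map_zero] at h2
    exact e.equivFun.symm.map_eq_zero_iff.1 (Subtype.ext h2.symm)
  have hunit : IsUnit G.det :=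
    (Matrix.isUnit_iff_isUnit_det G).1 (Matrix.mulVec_injective_iff_isUnit.1 hinj)
  set z := G⁻¹ *ᵥ (Rᵀ *ᵥ (stiffness A ψ *ᵥ x)) with hz
  have hGz : G *ᵥ z = Rᵀ *ᵥ (stiffness A ψ *ᵥ x) := by
    rw [hz, Matrix.mulVec_mulVec, Matrix.mul_nonsing_inv _ hunit, Matrix.one_mulVec]
  obtain ⟨y, hy⟩ : ∃ y, ψ.equivFun.symm (R *ᵥ y) = w := by
    refine ⟨e.equivFun ⟨w, hw⟩, ?_⟩
    rw [equivFun_symm_embeddingMatrix, LinearEquiv.symm_apply_apply]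
  rw [energy_comm hA subset_rfl, ← equivFun_symm_embeddingMatrix (ψ := ψ), ← map_sub, ← hy,
    energy_equivFun_symm hA hΩb hΩo, ← hadj, Matrix.mulVec_sub, Matrix.mulVec_sub, ← hGz, ← hGv,
    sub_self, dotProduct_zero]

variable {D : Decomposition 𝒯 M} {χ : Fin M → Pt d → ℝ} {q : Fin M → ℕ}

theorem equivFun_symm_oneLevel
    (e : ∀ i, Module.Basis (Fin (q i)) ℝ (localSpaceZero 𝒯 r (D.ovs i))) (y : Fin n → ℝ) :
    ψ.equivFun.symm (oneLevel A D χ ψ e *ᵥ y) =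
      ∑ i, localize r D χ i ((e i).equivFun.symm
        (((embeddingMatrix ψ (e i))ᵀ * stiffness A ψ * embeddingMatrix ψ (e i))⁻¹ *ᵥ
          ((embeddingMatrix ψ (e i))ᵀ *ᵥ y)) : femSpace 𝒯 r) := by
  rw [oneLevel, Matrix.sum_mulVec, map_sum]
  refine Finset.sum_congr rfl fun i _ => ?_
  rw [← Matrix.mulVec_mulVec, ← Matrix.mulVec_mulVec, ← Matrix.mulVec_mulVec,
    equivFun_symm_embeddingMatrix, equivFun_symm_toMatrix]
  rfl

/-- The hybrid form makes the error operator a product: the one-level step followed by the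
complement of the coarse projection. -/
theorem one_sub_preconditioner_mulVec {s : ℕ} {S : Submodule ℝ (femSpace 𝒯 r)}
    (e : ∀ i, Module.Basis (Fin (q i)) ℝ (localSpaceZero 𝒯 r (D.ovs i)))
    (eS : Module.Basis (Fin s) ℝ S) (x : Fin n → ℝ) :
    (1 - preconditioner A D χ ψ e eS * stiffness A ψ) *ᵥ x =
      (x - oneLevel A D χ ψ e *ᵥ (stiffness A ψ *ᵥ x)) - coarseLevel A ψ eS *ᵥ (stiffness A ψ *ᵥ
        (x - oneLevel A D χ ψ e *ᵥ (stiffness A ψ *ᵥ x))) := by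
  simp only [preconditioner, Matrix.sub_mulVec, Matrix.add_mul, Matrix.mul_sub, Matrix.sub_mul,
    Matrix.add_mulVec, Matrix.mulVec_sub, Matrix.mulVec_mulVec, Matrix.one_mulVec, Matrix.mul_one,
    Matrix.mul_assoc]
  abel

/-- The error propagation operator of the two-level method is a contraction in the energy norm. -/
theorem aNorm_one_sub_preconditioner_le (hA : IsEllipticCoefficient Ω α β A)
    (hΩb : Bornology.IsBounded Ω) (hΩ : interior (closure Ω) = Ω) (hr : r ≠ 0)
    (hχ : IsPartitionOfUnity D χ)
    (hpos : ∀ x : Fin n → ℝ, x ≠ 0 → 0 < x ⬝ᵥ (stiffness A ψ *ᵥ x))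
    {N : Fin M → ℕ} {lam : ∀ i, Fin (N i) → ℝ≥0∞}
    {φ : ∀ i, Fin (N i) → localSpace 𝒯 r (D.ovs i)}
    (hφ : ∀ i, IsEigensystem A r D χ i (lam i) (φ i)) (m : Fin M → ℕ)
    (hm : (Finset.univ.sup fun i => nextEigenvalue (lam i) (m i)) ≠ ∞)
    (e : ∀ i, Module.Basis (Fin (q i)) ℝ (localSpaceZero 𝒯 r (D.ovs i)))
    {s : ℕ} (eS : Module.Basis (Fin s) ℝ (coarseSpace r D χ φ m)) (x : Fin n → ℝ) :
    aNorm (stiffness A ψ) ((1 - preconditioner A D χ ψ e eS * stiffness A ψ) *ᵥ x) ≤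
      (errorBound D lam m).toReal * aNorm (stiffness A ψ) x := by
  have hΩo : IsOpen Ω := hΩ ▸ isOpen_interior
  set v := ψ.equivFun.symm x with hv
  set p : Fin M → femSpace 𝒯 r := fun i => ((e i).equivFun.symm
        (((embeddingMatrix ψ (e i))ᵀ * stiffness A ψ * embeddingMatrix ψ (e i))⁻¹ *ᵥ
          ((embeddingMatrix ψ (e i))ᵀ *ᵥ (stiffness A ψ *ᵥ x))) : femSpace 𝒯 r) with hp
  set y := x - oneLevel A D χ ψ e *ᵥ (stiffness A ψ *ᵥ x) with hy
  -- Writing `v` as the sum of its localizations merges it with the local corrections.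
  have hyv : ψ.equivFun.symm y = ∑ i, localize r D χ i (v - p i) := by
    rw [hy, map_sub, equivFun_symm_oneLevel]
    simp only [map_sub]
    rw [Finset.sum_sub_distrib, sum_localize hχ hΩ hr]
  set s₀ : femSpace 𝒯 r := (eS.equivFun.symm
    (((embeddingMatrix ψ eS)ᵀ * stiffness A ψ * embeddingMatrix ψ eS)⁻¹ *ᵥ
      ((embeddingMatrix ψ eS)ᵀ *ᵥ (stiffness A ψ *ᵥ y))) : femSpace 𝒯 r) with hs₀
  have hcoarse : ψ.equivFun.symm (coarseLevel A ψ eS *ᵥ (stiffness A ψ *ᵥ y)) = s₀ := by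
    rw [coarseLevel, ← Matrix.mulVec_mulVec, ← Matrix.mulVec_mulVec,
      equivFun_symm_embeddingMatrix]
  have hmain := energy_two_level_le hA hΩb hΩ hφ m hm v p (fun i => Subtype.coe_prop _)
    (fun i w hw => galerkin_orthogonal hA hΩb hΩo hpos (e i) x hw) (s₀ := s₀)
    (Subtype.coe_prop _) fun w hw => by
      rw [← hyv]
      exact galerkin_orthogonal hA hΩb hΩo hpos eS y hw
  rw [aNorm_stiffness hA hΩb hΩo, aNorm_stiffness hA hΩb hΩo, one_sub_preconditioner_mulVec,
    ← hy, map_sub, hyv, hcoarse]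
  refine (Real.sqrt_le_sqrt hmain).trans_eq ?_
  rw [Real.sqrt_mul (by positivity), errorBound, ← ENNReal.toReal_rpow, Real.sqrt_eq_rpow,
    ENNReal.toReal_mul, ENNReal.toReal_mul, ENNReal.toReal_natCast, ENNReal.toReal_natCast]

end Matrices

/-- Needed because `0 * ∞ = 0` in `ℝ≥0∞`: a zero overlap number would hide an infinite eigenvalue in
`errorBound`. -/
theorem overlapNumber_ne_zero {d M : ℕ} {Ω : Set (Pt d)} {ω : Fin M → Set (Pt d)} {i : Fin M}
    {x : Pt d} (hx : x ∈ Ω) (hi : x ∈ ω i) : overlapNumber Ω ω ≠ 0 := by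
  have h1 := ncard_le_overlapNumber ω hx
  have h2 : 0 < {i | x ∈ ω i}.ncard := (Set.ncard_pos (Set.toFinite _)).2 ⟨i, hi⟩
  lia

end MSGFEM

end

/-! ### The convergence bound -/

open MSGFEM in
theorem theorem3p6 {d : ℕ} (hd : d = 2 ∨ d = 3)
    -- the domain (a Lipschitz domain is the interior of its closure) and the coefficient
    (Ω : Set (MSGFEM.Pt d)) (hΩ_bdd : Bornology.IsBounded Ω) (hΩ : interior (closure Ω) = Ω)
    (α β : ℝ) (A : MSGFEM.Pt d → Matrix (Fin d) (Fin d) ℝ)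
    (hA : MSGFEM.IsEllipticCoefficient Ω α β A)
    -- the mesh and the Lagrange finite element space of order `r`, with a basis
    (𝒯 : MSGFEM.Mesh Ω) (r : ℕ) (hr : 1 ≤ r)
    {n : ℕ} (ψ : Module.Basis (Fin n) ℝ (MSGFEM.femSpace 𝒯 r))
    -- subdomains, oversampling domains, partition of unity
    {M : ℕ} (D : MSGFEM.Decomposition 𝒯 M)
    (χ : Fin M → MSGFEM.Pt d → ℝ) (hχ : MSGFEM.IsPartitionOfUnity D χ)
    -- local eigenpairs and the numbers of eigenfunctions used
    {N : Fin M → ℕ} (lam : ∀ i, Fin (N i) → ENNReal)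
    (φ : ∀ i, Fin (N i) → MSGFEM.localSpace 𝒯 r (D.ovs i))
    (hφ : ∀ i, MSGFEM.IsEigensystem A r D χ i (lam i) (φ i))
    (m : Fin M → ℕ) (hm : ∀ i, m i ≤ N i)
    -- bases of the local spaces and of the coarse space
    {q : Fin M → ℕ}
    (e : ∀ i, Module.Basis (Fin (q i)) ℝ (MSGFEM.localSpaceZero 𝒯 r (D.ovs i)))
    {s : ℕ} (eS : Module.Basis (Fin s) ℝ (MSGFEM.coarseSpace r D χ φ m))
    -- the stiffness matrix, the preconditioner and the linear system
    (AA B : Matrix (Fin n) (Fin n) ℝ) (hAA : AA = MSGFEM.stiffness A ψ)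
    (hB : B = MSGFEM.preconditioner A D χ ψ e eS)
    (ℓ : MSGFEM.femSpace 𝒯 r →ₗ[ℝ] ℝ)
    (u : Fin n → ℝ) (hu : AA *ᵥ u = fun k => ℓ (ψ k))
    -- the inner product, and the equivalence of the two norms
    (b : LinearMap.BilinForm ℝ (Fin n → ℝ)) (hb : MSGFEM.IsInnerProduct b)
    (b₁ b₂ : ℝ) (hb₁ : 0 < b₁) (hb₂ : 0 < b₂)
    (hnorm : ∀ v : Fin n → ℝ, b₁ * MSGFEM.bNorm b v ≤ MSGFEM.aNorm AA v ∧
      MSGFEM.aNorm AA v ≤ b₂ * MSGFEM.bNorm b v)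
    -- the error bound of the method and the GMRES iterates
    (Λ : ENNReal) (hΛ : Λ = MSGFEM.errorBound D lam m) (hΛ1 : Λ < 1)
    (x : ℕ → Fin n → ℝ) (hx : MSGFEM.IsGMRESSequence b (B * AA) u x)
    (j : ℕ) (hj : 1 ≤ j) :
    MSGFEM.bNorm b ((B * AA) *ᵥ (u - x j)) ≤
      Λ.toReal ^ j * ((1 + Λ.toReal) / (1 - Λ.toReal)) * (b₂ / b₁) *
        MSGFEM.bNorm b ((B * AA) *ᵥ (u - x 0)) := by
  subst hAA hB hΛ
  have hb_zero : bNorm b 0 = 0 := bNorm_zero b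
  -- For empty `Ω` the overlap numbers vanish and `Λ < 1` says nothing about the eigenvalues, but
  -- then `V_h` is trivial.
  rcases Set.eq_empty_or_nonempty Ω with hempty | ⟨z, hz⟩
  · have hsub : Subsingleton (femSpace 𝒯 r) := ⟨fun v w => by
      ext y
      have hy : y ∉ Ω := by simp [hempty]
      rw [v.2.2.1 y hy, w.2.2.1 y hy]⟩
    have hsub' : Subsingleton (Fin n → ℝ) := ψ.equivFun.symm.injective.subsingleton
    rw [Subsingleton.elim ((preconditioner A D χ ψ e eS * stiffness A ψ) *ᵥ (u - x j)) 0,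
      Subsingleton.elim ((preconditioner A D χ ψ e eS * stiffness A ψ) *ᵥ (u - x 0)) 0, hb_zero,
      mul_zero]
  -- Definiteness comes from the norm equivalence with the inner product `b`, so no Poincaré
  -- inequality is required.
  have hpos : ∀ v : Fin n → ℝ, v ≠ 0 → 0 < v ⬝ᵥ (stiffness A ψ *ᵥ v) := by
    intro v hv
    have h1 : 0 < b₁ * bNorm b v := mul_pos hb₁ (Real.sqrt_pos.2 (hb.pos v hv))
    exact Real.sqrt_pos.1 (h1.trans_le (hnorm v).1)
  obtain ⟨i, hi⟩ : ∃ i, z ∈ D.dom i := by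
    rw [← D.cover] at hz
    exact Set.mem_iUnion.1 hz
  have hξ := overlapNumber_ne_zero (ω := D.dom) hz hi
  have hξ' := overlapNumber_ne_zero (ω := D.ovs) hz (D.dom_subset_over i hi)
  have hfin : (Finset.univ.sup fun i => nextEigenvalue (lam i) (m i)) ≠ ⊤ := by
    intro htop
    rw [errorBound, htop, ENNReal.mul_top (mul_ne_zero (Nat.cast_ne_zero.2 hξ)
      (Nat.cast_ne_zero.2 hξ')), ENNReal.top_rpow_of_pos (by norm_num)] at hΛ1
    exact absurd hΛ1 (by simp)
  set L := (errorBound D lam m).toReal with hL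
  have hL0 : 0 ≤ L := ENNReal.toReal_nonneg
  have hL1 : L < 1 := by
    have := (ENNReal.toReal_lt_toReal (ne_top_of_lt hΛ1) ENNReal.one_ne_top).2 hΛ1
    rwa [ENNReal.toReal_one] at this
  have hmain := gmres_bound hx hb₁ hnorm hL0 (aNorm_one_sub_preconditioner_le hA hΩ_bdd hΩ
    (by lia) hχ hpos hφ m hfin e eS) hj
  refine hmain.trans (mul_le_mul_of_nonneg_right ?_ (Real.sqrt_nonneg _))
  refine mul_le_mul_of_nonneg_right (le_mul_of_one_le_right (pow_nonneg hL0 j) ?_) (by positivity)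
  rw [le_div_iff₀ (by linarith)]
  linarith
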